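/- Let $\mathbb{K}$ be an algebraically closed field of characteristic zero. For a finite simple graph $G$, let $\mathbb{K}[V(G)]$ and $\mathbb{K}[E(G)]$ be the polynomial rings whose variables are the vertices, respectively the edges, of $G$. The toric ideal $I_G \subseteq \mathbb{K}[E(G)]$ is the kernel of the $\mathbb{K}$-algebra homomorphism $\varphi_G : \mathbb{K}[E(G)] \to \mathbb{K}[V(G)]$ with $\varphi_G(e) = x x'$ for every edge $e = \{x, x'\}$. Let $R = \mathbb{K}[x_1,\ldots,x_n]$ and let $y$ be one of its variables. A nonzero $f \in R$ can be written as $f = \sum_{i=0}^{d} \alpha_i y^i$ with $\alpha_i$ free of $y$ and $\alpha_d \neq 0$; put $\mathrm{in}_y(f) = \alpha_d y^d$, and $\mathrm{in}_y(I) = \langle \mathrm{in}_y(f) \mid 0 \neq f \in I\rangle$ for an ideal $I$. A monomial order $<$ is $y$-compatible if $\mathrm{in}_<(f) = \mathrm{in}_<(\mathrm{in}_y(f))$ for all nonzero $f \in R$. Given such an order and a Gröbner basis $\{g_1,\ldots,g_m\}$ of $I$ with respect to it, write $\mathrm{in}_y(g_i) = y^{d_i} q_i$ with $y$ dividing no term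 of $q_i$, and set $C_{y,I} = \langle q_1,\ldots,q_m\rangle$ and $N_{y,I} = \langle q_i \mid d_i = 0\rangle$. An ideal $I$ of $R$ is unmixed if $\dim(R/I) = \dim(R/P)$ for all $P \in \mathrm{Ass}_R(R/I)$. An ideal $I$ of $R$ is geometrically vertex decomposable (recursively in the number $n \geq 0$ of variables) if $I$ is unmixed and either 1. $I = \langle 1 \rangle$, or $I$ is generated by a (possibly empty) subset of the variables; or 2. there are a variable $y$ of $R$ and a $y$-compatible monomial order such that $\mathrm{in}_y(I) = C_{y,I} \cap (N_{y,I} + \langle y \rangle)$, and the contractions of $C_{y,I}$ and $N_{y,I}$ to the polynomial ring in the variables other than $y$ are geometrically vertex decomposable. **Theorem.** Suppose that $G = H \sqcup K$ is the disjoint union of two finite simple graphs $H$ and $K$. Then $I_G$ is geometrically vertex decomposable in $\mathbb{K}[E(G)]$ if and only if $I_H$ is geometrically vertex decomposable in $\mathbb{K}[E(H)]$ and $I_K$ is geometrically vertex decomposable in $\mathbb{K}[E(K)]$. -/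

import Mathlib

open MvPolynomial

universe u v w

noncomputable section

namespace GVD

variable {σ : Type u} {K : Type v} [Field K]

/-- The coefficient `α_d` of the highest power `y ^ d` of the variable `y` occurring in `f`, when
`f` is written as `∑ i, α_i * y ^ i` with the `α_i` free of `y`. Here `d = f.degreeOf y`. -/
def topCoeff (y : σ) (f : MvPolynomial σ K) : MvPolynomial σ K :=
  ∑ m ∈ f.support with m y = f.degreeOf y, monomial (m.erase y) (f.coeff m)

/-- The initial `y`-form `in_y(f) = α_d * y ^ d` of `f` (and `0` for `f = 0`). -/
def initForm (y : σ) (f : MvPolynomial σ K) : MvPolynomial σ K :=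
  X y ^ f.degreeOf y * topCoeff y f

/-- The ideal `in_y(I)` generated by the initial `y`-forms of the elements of `I`. -/
def initFormIdeal (y : σ) (I : Ideal (MvPolynomial σ K)) : Ideal (MvPolynomial σ K) :=
  Ideal.span (initForm y '' (I : Set (MvPolynomial σ K)))

/-- The initial ideal `in_<(I)` of `I` with respect to a monomial order. -/
def initIdeal (m : MonomialOrder.{u, w} σ) (I : Ideal (MvPolynomial σ K)) :
    Ideal (MvPolynomial σ K) :=
  Ideal.span (m.leadingTerm '' (I : Set (MvPolynomial σ K)))

/-- A monomial order is `y`-compatible, over `K`, if `in_<(f) = in_<(in_y(f))` for all `f`. -/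
def IsCompatible (K : Type v) [Field K] (m : MonomialOrder.{u, w} σ) (y : σ) : Prop :=
  ∀ f : MvPolynomial σ K, m.leadingTerm f = m.leadingTerm (initForm y f)

/-- The finite set `B` is a Gröbner basis of `I` with respect to a monomial order: it consists of
nonzero elements of `I` whose initial terms generate the initial ideal of `I`. -/
structure IsGroebnerBasis (m : MonomialOrder.{u, w} σ) (I : Ideal (MvPolynomial σ K))
    (B : Finset (MvPolynomial σ K)) : Prop where
  subset : (B : Set (MvPolynomial σ K)) ⊆ I
  ne_zero : ∀ g ∈ B, g ≠ 0
  span_eq : Ideal.span (m.leadingTerm '' (B : Set (MvPolynomial σ K))) = initIdeal m I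

/-- The ideal `C_{y,I} = ⟨q_1, …, q_m⟩` attached to a Gröbner basis `g_i = y ^ d_i * q_i + r_i`,
where `in_y(g_i) = y ^ d_i * q_i`. -/
def idealC (y : σ) (B : Finset (MvPolynomial σ K)) : Ideal (MvPolynomial σ K) :=
  Ideal.span (topCoeff y '' (B : Set (MvPolynomial σ K)))

/-- The ideal `N_{y,I} = ⟨q_i | d_i = 0⟩` attached to a Gröbner basis `g_i = y ^ d_i * q_i + r_i`,
where `in_y(g_i) = y ^ d_i * q_i`. -/
def idealN (y : σ) (B : Finset (MvPolynomial σ K)) : Ideal (MvPolynomial σ K) :=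
  Ideal.span (topCoeff y '' {g | g ∈ B ∧ g.degreeOf y = 0})

/-- The contraction of an ideal to the polynomial ring in all the variables except `y`. -/
def contract (y : σ) (I : Ideal (MvPolynomial σ K)) : Ideal (MvPolynomial {x : σ // x ≠ y} K) :=
  I.comap (rename (R := K) (Subtype.val : {x : σ // x ≠ y} → σ))

/-- An ideal `I` of `R` is unmixed if `dim (R/I) = dim (R/P)` for every associated prime `P` of
the `R`-module `R/I`. -/
def IsUnmixed {R : Type*} [CommRing R] (I : Ideal R) : Prop :=
  ∀ P ∈ associatedPrimes R (R ⧸ I), ringKrullDim (R ⧸ I) = ringKrullDim (R ⧸ P)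

/-- Geometrically vertex decomposable ideals of a polynomial ring in finitely many variables.
In `decomp`, the type that carries the monomial order is taken in `Type`: as there are only
countably many monomials in finitely many variables, every monomial order is covered. -/
inductive IsGVD {K : Type v} [Field K] :
    {σ : Type u} → Ideal (MvPolynomial σ K) → Prop
  | top {σ : Type u} (hU : IsUnmixed (⊤ : Ideal (MvPolynomial σ K))) :
      IsGVD (⊤ : Ideal (MvPolynomial σ K))
  | variables {σ : Type u} (I : Ideal (MvPolynomial σ K)) (hU : IsUnmixed I)
      (s : Set σ) (hs : I = Ideal.span (X '' s)) : IsGVD I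
  | decomp {σ : Type u} (I : Ideal (MvPolynomial σ K)) (hU : IsUnmixed I)
      (y : σ) (m : MonomialOrder.{u, 0} σ) (hm : IsCompatible K m y)
      (B : Finset (MvPolynomial σ K)) (hB : IsGroebnerBasis m I B)
      (hI : initFormIdeal y I = idealC y B ⊓ (idealN y B ⊔ Ideal.span {X y}))
      (hC : IsGVD (contract y (idealC y B)))
      (hN : IsGVD (contract y (idealN y B))) : IsGVD I

/-- The toric ideal of a graph `G` over `K`: the kernel of the `K`-algebra homomorphism
`K[E(G)] → K[V(G)]` that sends an edge `{a, b}` to `a * b`. -/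
def toricIdeal (K : Type v) [Field K] {V : Type u} (G : SimpleGraph V) :
    Ideal (MvPolynomial G.edgeSet K) :=
  RingHom.ker (aeval (R := K) fun e : G.edgeSet =>
    ((e : Sym2 V).map (X : V → MvPolynomial V K)).mul)

end GVD

end

-- The toric ideal of a disjoint union is the `join` of the two toric ideals: the sum of their
-- extensions to the polynomial ring in both blocks of variables (`toricIdeal_sum`). Both ideals are
-- proper, so everything rests on a statement about arbitrary proper ideals in disjoint sets of
-- variables, `isGVD_join_iff`.
--
-- The definition of a decomposition step involves a monomial order and a Gröbner basis, but its
-- content does not depend on them. Write the ring as polynomials in `y` over the remaining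
-- variables. Then C is extended from the ideal of all leading coefficients, N from the contraction
-- of I (leading coefficients in degree 0), and the equation for in_y(I) says exactly that every
-- leading coefficient already occurs in degree at most 1 (`IsGroebnerBasis.idealC_eq`,
-- `IsGroebnerBasis.idealN_eq`, `initFormIdeal_eq_iff`).
--
-- These ideals commute with joins: for `y` in the first block, the ideal of degree-n leading
-- coefficients of the join is the join of that of I with J (`leadingCoeffNth_join`). The tool is
-- `mem_join_iff`: over a field, f lies in the join iff applying to its second block any functional
-- that vanishes on J gives an element of I.
--
-- Unmixedness passes between the join and its factors by Noether normalization: it means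
-- torsion-freeness over the normalizing polynomial ring (`isUnmixed_iff`), which behaves well under
-- tensor products over a field (`isUnmixed_join_iff`). Induction on the recursive definition then
-- gives both directions (`IsGVD.join`, `IsGVD.of_join`).

universe x

noncomputable section

namespace GVD

open TensorProduct

/-! ### Krull dimension of integral extensions and a torsion criterion for unmixedness -/

section Dimension

/-- Incomparability makes contraction of primes strictly monotone, which bounds the dimension above;
lying over and going up lift chains of primes, which bounds it below. -/
theorem ringKrullDim_eq_of_injective_of_isIntegral {S A : Type*} [CommRing S] [CommRing A]
    (g : S →+* A) (hg : Function.Injective g) (hi : g.IsIntegral) :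
    ringKrullDim A = ringKrullDim S := by
  algebraize [g]
  apply le_antisymm
  · refine Order.krullDim_le_of_strictMono (PrimeSpectrum.comap (algebraMap S A)) ?_
    intro P Q h
    exact Ideal.IsIntegral.comap_lt_comap (R := S) (I := P.asIdeal) (J := Q.asIdeal) h
  · have key : ∀ l : LTSeries (PrimeSpectrum S), ∃ L : LTSeries (PrimeSpectrum A),
        L.length = l.length ∧ PrimeSpectrum.comap (algebraMap S A) L.last = l.last := by
      intro l
      induction l using RelSeries.inductionOn' with
      | singleton p =>
        obtain ⟨Q, -, hQ, hp⟩ := Ideal.exists_ideal_over_prime_of_isIntegral (S := A) p.asIdeal ⊥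
          (by
            rw [← RingHom.ker_eq_comap_bot, (RingHom.injective_iff_ker_eq_bot (algebraMap S A)).mp hg]
            exact bot_le)
        exact ⟨RelSeries.singleton _ ⟨Q, hQ⟩, rfl, PrimeSpectrum.ext hp⟩
      | snoc l q lt ih =>
        obtain ⟨L, hL, hlast⟩ := ih
        have hlt : l.last < q := lt
        obtain ⟨Q, hle, hQ, hq⟩ := Ideal.exists_ideal_over_prime_of_isIntegral (S := A)
          q.asIdeal L.last.asIdeal (by
            rw [← hlast] at hlt
            exact hlt.le)
        have hne : L.last < (⟨Q, hQ⟩ : PrimeSpectrum A) := by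
          refine lt_of_le_of_ne hle ?_
          rintro h
          rw [← hlast, h] at hlt
          exact hlt.ne (PrimeSpectrum.ext hq)
        exact ⟨L.snoc ⟨Q, hQ⟩ hne, by simp [hL], by simpa using PrimeSpectrum.ext hq⟩
    refine iSup_le fun l => ?_
    obtain ⟨L, hL, -⟩ := key l
    rw [← hL]
    exact le_iSup (fun L : LTSeries (PrimeSpectrum A) => ((L.length : ℕ∞) : WithBot ℕ∞)) L

/-- For an associated prime P, R/P is integral over S/(P ∩ S), so it has the full dimension dim S
exactly when P ∩ S = 0. Since the zero divisors on R/I are the elements of associated primes, this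
holds for all P iff no nonzero element of S kills a nonzero element. -/
theorem isUnmixed_iff {R S : Type*} [CommRing R] [IsNoetherianRing R] [CommRing S] [IsDomain S]
    [FiniteRingKrullDim S] (I : Ideal R) (g : S →+* R ⧸ I) (hg : Function.Injective g)
    (hi : g.IsIntegral) :
    IsUnmixed I ↔ ∀ s ≠ 0, ∀ a, g s * a = 0 → a = 0 := by
  have hdim := ringKrullDim_eq_of_injective_of_isIntegral g hg hi
  constructor
  · intro h s hs a hsa
    by_contra ha
    obtain ⟨P, hP, hle⟩ := exists_le_isAssociatedPrime_of_isNoetherianRing R a ha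
    obtain ⟨hPp, x, hx⟩ := isAssociatedPrime_iff.mp hP
    have hIP : I ≤ P := by
      intro r hr
      rw [hx, Submodule.mem_colon_singleton, Submodule.mem_bot, Algebra.smul_def,
        Ideal.Quotient.algebraMap_eq, Ideal.Quotient.eq_zero_iff_mem.mpr hr, zero_mul]
    let q : R ⧸ I →+* R ⧸ P := Ideal.Quotient.factor hIP
    have hq : Function.Surjective q := Ideal.Quotient.factor_surjective hIP
    have hqs : q (g s) = 0 := by
      obtain ⟨r, hr⟩ := Ideal.Quotient.mk_surjective (g s)
      rw [← hr, Ideal.Quotient.factor_mk, Ideal.Quotient.eq_zero_iff_mem]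
      apply hle
      rw [Submodule.mem_colon_singleton, Submodule.mem_bot, Algebra.smul_def,
        Ideal.Quotient.algebraMap_eq, hr, hsa]
    have hqi : (q.comp g).IsIntegral := hi.trans _ _ (q.isIntegral_of_surjective hq)
    have hki : (RingHom.kerLift (q.comp g)).IsIntegral := by
      refine RingHom.IsIntegral.tower_top (Ideal.Quotient.mk _) _ ?_
      have hcomp : (RingHom.kerLift (q.comp g)).comp (Ideal.Quotient.mk _) = q.comp g :=
        RingHom.ext fun _ => rfl
      exact hcomp ▸ hqi
    have h1 := ringKrullDim_eq_of_injective_of_isIntegral _ (RingHom.kerLift_injective (q.comp g))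
      hki
    have h2 : ringKrullDim (S ⧸ RingHom.ker (q.comp g)) ≤ ringKrullDim (S ⧸ Ideal.span {s}) := by
      have hle : Ideal.span {s} ≤ RingHom.ker (q.comp g) := by
        rw [Ideal.span_singleton_le_iff_mem]
        exact hqs
      exact ringKrullDim_le_of_surjective _ (Ideal.Quotient.factor_surjective hle)
    have h3 := ringKrullDim_quotient_succ_le_of_nonZeroDivisor (mem_nonZeroDivisors_of_ne_zero hs)
    rw [← h1, ← h P hP, hdim] at h2
    have h4 : ringKrullDim S + 1 ≤ ringKrullDim S := le_trans (by gcongr) h3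
    -- The inequality d + 1 ≤ d is absurd only for finite d, which is where the finite dimension of
    -- S enters.
    obtain ⟨hbot, htop⟩ := finiteRingKrullDim_iff_ne_bot_and_top.mp ‹FiniteRingKrullDim S›
    generalize ringKrullDim S = d at h4 hbot htop
    lift d to ℕ∞ using hbot
    lift d to ℕ using fun h => htop (by rw [h]; rfl)
    norm_cast at h4
    omega
  · intro h P hP
    obtain ⟨hPp, x, hx⟩ := isAssociatedPrime_iff.mp hP
    have hIP : I ≤ P := by
      intro r hr
      rw [hx, Submodule.mem_colon_singleton, Submodule.mem_bot, Algebra.smul_def,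
        Ideal.Quotient.algebraMap_eq, Ideal.Quotient.eq_zero_iff_mem.mpr hr, zero_mul]
    let q : R ⧸ I →+* R ⧸ P := Ideal.Quotient.factor hIP
    have hq : Function.Surjective q := Ideal.Quotient.factor_surjective hIP
    have hqi : (q.comp g).IsIntegral := hi.trans _ _ (q.isIntegral_of_surjective hq)
    rw [hdim, ringKrullDim_eq_of_injective_of_isIntegral (q.comp g) _ hqi]
    rw [injective_iff_map_eq_zero]
    intro s hs
    by_contra hs0
    obtain ⟨r, hr⟩ := Ideal.Quotient.mk_surjective (g s)
    rw [RingHom.comp_apply, ← hr, Ideal.Quotient.factor_mk, Ideal.Quotient.eq_zero_iff_mem, hx,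
      Submodule.mem_colon_singleton, Submodule.mem_bot, Algebra.smul_def,
      Ideal.Quotient.algebraMap_eq, hr] at hs
    refine hPp.ne_top ?_
    rw [hx, h s hs0 x hs]
    simp

end Dimension

/-! ### Joins of ideals in disjoint variables, tested by linear functionals -/

section Slice

variable {K : Type*} [Field K] {σ τ ρ : Type*}

/-- The ideal of `K[ρ]` generated by ideals of `K[σ]` and `K[τ]`, where `σ ⊕ τ ≃ ρ`. -/
def join (e : σ ⊕ τ ≃ ρ) (I : Ideal (MvPolynomial σ K)) (J : Ideal (MvPolynomial τ K)) :
    Ideal (MvPolynomial ρ K) :=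
  I.map (rename (R := K) (e ∘ Sum.inl)) ⊔ J.map (rename (R := K) (e ∘ Sum.inr))

/-- The isomorphism `K[σ] ⊗ K[τ] ≃ K[ρ]` attached to `σ ⊕ τ ≃ ρ`. -/
def splitEquiv (K : Type*) [Field K] (e : σ ⊕ τ ≃ ρ) :
    MvPolynomial σ K ⊗[K] MvPolynomial τ K ≃ₐ[K] MvPolynomial ρ K :=
  (tensorEquivSum K σ τ K).trans (renameEquiv K e)

theorem splitEquiv_comp_includeLeft (e : σ ⊕ τ ≃ ρ) :
    (splitEquiv K e).toAlgHom.comp Algebra.TensorProduct.includeLeft = rename (e ∘ Sum.inl) := by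
  ext; simp [splitEquiv]

theorem splitEquiv_comp_includeRight (e : σ ⊕ τ ≃ ρ) :
    (splitEquiv K e).toAlgHom.comp Algebra.TensorProduct.includeRight =
      rename (e ∘ Sum.inr) := by
  ext; simp [splitEquiv]

theorem splitEquiv_tmul (e : σ ⊕ τ ≃ ρ) (a : MvPolynomial σ K) (b : MvPolynomial τ K) :
    splitEquiv K e (a ⊗ₜ b) = rename (e ∘ Sum.inl) a * rename (e ∘ Sum.inr) b := by
  rw [← splitEquiv_comp_includeLeft, ← splitEquiv_comp_includeRight]
  simp [← map_mul]

/-- Evaluation of a linear functional in the second block of variables. -/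
def slice (e : σ ⊕ τ ≃ ρ) (l : Module.Dual K (MvPolynomial τ K)) :
    MvPolynomial ρ K →ₗ[K] MvPolynomial σ K :=
  (TensorProduct.rid K _).toLinearMap ∘ₗ l.lTensor (MvPolynomial σ K) ∘ₗ
    (splitEquiv K e).symm.toLinearMap

theorem slice_mul (e : σ ⊕ τ ≃ ρ) (l : Module.Dual K (MvPolynomial τ K))
    (a : MvPolynomial σ K) (b : MvPolynomial τ K) :
    slice e l (rename (e ∘ Sum.inl) a * rename (e ∘ Sum.inr) b) = l b • a := by
  rw [← splitEquiv_tmul]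
  simp [slice]

theorem slice_rename_inl (e : σ ⊕ τ ≃ ρ) (l : Module.Dual K (MvPolynomial τ K))
    (a : MvPolynomial σ K) : slice e l (rename (e ∘ Sum.inl) a) = l 1 • a := by
  simpa using slice_mul e l a 1

@[elab_as_elim]
theorem mul_induction (e : σ ⊕ τ ≃ ρ) {p : MvPolynomial ρ K → Prop} (f : MvPolynomial ρ K)
    (mul : ∀ a b, p (rename (e ∘ Sum.inl) a * rename (e ∘ Sum.inr) b))
    (add : ∀ f g, p f → p g → p (f + g)) : p f := by
  obtain ⟨z, rfl⟩ := (splitEquiv K e).surjective f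
  induction z with
  | zero => simpa using mul 0 0
  | tmul a b => simpa [splitEquiv_tmul] using mul a b
  | add x y hx hy => simpa using add _ _ hx hy

theorem map_splitEquiv (e : σ ⊕ τ ≃ ρ) (I : Ideal (MvPolynomial σ K))
    (J : Ideal (MvPolynomial τ K)) :
    (I.map (Algebra.TensorProduct.includeLeft : _ →ₐ[K] MvPolynomial σ K ⊗[K] MvPolynomial τ K) ⊔
      J.map (Algebra.TensorProduct.includeRight :
        _ →ₐ[K] MvPolynomial σ K ⊗[K] MvPolynomial τ K)).map (splitEquiv K e).toAlgHom =
      join e I J := by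
  rw [Ideal.map_sup, Ideal.map_mapₐ, Ideal.map_mapₐ, splitEquiv_comp_includeLeft,
    splitEquiv_comp_includeRight]
  rfl

theorem ker_tensorMap_mk (I : Ideal (MvPolynomial σ K)) (J : Ideal (MvPolynomial τ K)) :
    RingHom.ker (Algebra.TensorProduct.map (Ideal.Quotient.mkₐ K I) (Ideal.Quotient.mkₐ K J)) =
    (I.map (Algebra.TensorProduct.includeLeft : _ →ₐ[K] MvPolynomial σ K ⊗[K] MvPolynomial τ K) ⊔
      J.map (Algebra.TensorProduct.includeRight :
        _ →ₐ[K] MvPolynomial σ K ⊗[K] MvPolynomial τ K)) := by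
  have h := Algebra.TensorProduct.map_ker (Ideal.Quotient.mkₐ K I) (Ideal.Quotient.mkₐ K J)
    (Ideal.Quotient.mkₐ_surjective K I) (Ideal.Quotient.mkₐ_surjective K J)
  have hI : RingHom.ker (Ideal.Quotient.mkₐ K I) = I := Ideal.Quotient.mkₐ_ker K I
  have hJ : RingHom.ker (Ideal.Quotient.mkₐ K J) = J := Ideal.Quotient.mkₐ_ker K J
  rw [h, hI, hJ]

theorem mem_join_iff_tensorMap (e : σ ⊕ τ ≃ ρ) (I : Ideal (MvPolynomial σ K))
    (J : Ideal (MvPolynomial τ K)) (f : MvPolynomial ρ K) :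
    f ∈ join e I J ↔ Algebra.TensorProduct.map (Ideal.Quotient.mkₐ K I) (Ideal.Quotient.mkₐ K J)
      ((splitEquiv K e).symm f) = 0 := by
  rw [← RingHom.mem_ker, ker_tensorMap_mk, ← map_splitEquiv]
  refine (Ideal.mem_map_of_equiv (splitEquiv K e) f).trans ⟨?_, fun h => ⟨_, h, by simp⟩⟩
  rintro ⟨x, hx, rfl⟩
  simpa using hx

/-- The coordinate functionals of a basis of B already detect every element of the tensor product.
-/
theorem tensor_eq_zero_of_forall_dual {A B : Type*} [AddCommGroup A] [Module K A]
    [AddCommGroup B] [Module K B] (z : A ⊗[K] B)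
    (h : ∀ l : Module.Dual K B, TensorProduct.rid K A (l.lTensor A z) = 0) : z = 0 := by
  let b := Module.Free.chooseBasis K B
  apply (TensorProduct.equivFinsuppOfBasisRight b).injective
  ext i
  have := h (b.coord i)
  rw [map_zero, Finsupp.zero_apply, ← this]
  clear h this
  induction z with
  | zero => simp
  | tmul x y => simp
  | add x y hx hy => simp only [map_add, Finsupp.add_apply, hx, hy]

/-- The quotient by the join is K[σ]/I ⊗ K[τ]/J, where functionals on the second factor detect zero;
those functionals are the functionals on K[τ] that vanish on J. -/
theorem mem_join_iff (e : σ ⊕ τ ≃ ρ) (I : Ideal (MvPolynomial σ K))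
    (J : Ideal (MvPolynomial τ K)) (f : MvPolynomial ρ K) :
    f ∈ join e I J ↔ ∀ l : Module.Dual K (MvPolynomial τ K), (∀ b ∈ J, l b = 0) →
      slice e l f ∈ I := by
  rw [mem_join_iff_tensorMap]
  have key : ∀ (l : Module.Dual K (MvPolynomial τ K ⧸ J)),
      Ideal.Quotient.mkₐ K I (slice e (l ∘ₗ (Ideal.Quotient.mkₐ K J).toLinearMap) f) =
      TensorProduct.rid K _ (l.lTensor _ (Algebra.TensorProduct.map (Ideal.Quotient.mkₐ K I)
        (Ideal.Quotient.mkₐ K J) ((splitEquiv K e).symm f))) := by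
    intro l
    obtain ⟨z, rfl⟩ := (splitEquiv K e).surjective f
    simp only [slice, LinearMap.comp_apply, AlgEquiv.symm_apply_apply, AlgEquiv.toLinearMap_apply]
    induction z with
    | zero => simp
    | tmul a b => simp
    | add x y hx hy => simp only [map_add, hx, hy]
  constructor
  · intro h l hl
    have := key ((J.restrictScalars K).liftQ l hl)
    rw [h, map_zero, map_zero, Ideal.Quotient.mkₐ_eq_mk, Ideal.Quotient.eq_zero_iff_mem] at this
    exact this
  · intro h
    apply tensor_eq_zero_of_forall_dual
    intro l
    rw [← key, Ideal.Quotient.mkₐ_eq_mk, Ideal.Quotient.eq_zero_iff_mem]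
    apply h
    intro b hb
    simp [Ideal.Quotient.eq_zero_iff_mem.mpr hb]

theorem exists_dual_of_ne_top {J : Ideal (MvPolynomial τ K)} (hJ : J ≠ ⊤) :
    ∃ l : Module.Dual K (MvPolynomial τ K), (∀ b ∈ J, l b = 0) ∧ l 1 = 1 := by
  have h1 : (1 : MvPolynomial τ K) ∉ J.restrictScalars K := by
    simpa using (Ideal.ne_top_iff_one J).mp hJ
  obtain ⟨l, hl, hl'⟩ := Submodule.exists_le_ker_of_notMem h1
  refine ⟨(l 1)⁻¹ • l, fun b hb => ?_, by simp [hl]⟩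
  have : l b = 0 := hl' hb
  simp [this]

/-- As J is proper, some functional vanishes on J and takes the value 1 at 1; its slice retracts the
join onto I. -/
theorem rename_inl_mem_join_iff (e : σ ⊕ τ ≃ ρ) (I : Ideal (MvPolynomial σ K))
    {J : Ideal (MvPolynomial τ K)} (hJ : J ≠ ⊤) (a : MvPolynomial σ K) :
    rename (e ∘ Sum.inl) a ∈ join e I J ↔ a ∈ I := by
  constructor
  · intro h
    obtain ⟨l, hl, h1⟩ := exists_dual_of_ne_top hJ
    simpa [slice_rename_inl, h1] using (mem_join_iff e I J _).mp h l hl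
  · intro h
    exact Ideal.mem_sup_left (Ideal.mem_map_of_mem _ h)

theorem join_sumComm (e : σ ⊕ τ ≃ ρ) (I : Ideal (MvPolynomial σ K))
    (J : Ideal (MvPolynomial τ K)) : join ((Equiv.sumComm τ σ).trans e) J I = join e I J := by
  rw [join, sup_comm]
  rfl

theorem join_top_left (e : σ ⊕ τ ≃ ρ) (J : Ideal (MvPolynomial τ K)) :
    join e (⊤ : Ideal (MvPolynomial σ K)) J = ⊤ := by
  simp [join, Ideal.map_top]

theorem join_top_right (e : σ ⊕ τ ≃ ρ) (I : Ideal (MvPolynomial σ K)) :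
    join e I (⊤ : Ideal (MvPolynomial τ K)) = ⊤ := by
  simp [join, Ideal.map_top]

theorem join_le_join_left_iff (e : σ ⊕ τ ≃ ρ) {I I' : Ideal (MvPolynomial σ K)}
    {J : Ideal (MvPolynomial τ K)} (hJ : J ≠ ⊤) : join e I J ≤ join e I' J ↔ I ≤ I' := by
  constructor
  · intro h a ha
    exact (rename_inl_mem_join_iff e I' hJ a).mp
      (h ((rename_inl_mem_join_iff e I hJ a).mpr ha))
  · intro h
    exact sup_le_sup_right (Ideal.map_mono h) _

theorem join_ne_top (e : σ ⊕ τ ≃ ρ) {I : Ideal (MvPolynomial σ K)}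
    {J : Ideal (MvPolynomial τ K)} (hI : I ≠ ⊤) (hJ : J ≠ ⊤) : join e I J ≠ ⊤ := by
  rw [Ideal.ne_top_iff_one] at hI ⊢
  rwa [← map_one (rename (R := K) (e ∘ Sum.inl)), rename_inl_mem_join_iff e I hJ]

end Slice

/-! ### Torsion-freeness and integrality of tensor products -/

section Tensor

/-- A maximal linearly independent subfamily of the generators spans a free submodule N. Each
generator has a nonzero multiple in N, so multiplication by the product of these multipliers maps M
into N, injectively because M is torsion-free. -/
theorem exists_injective_pi {R M : Type*} [CommRing R] [IsDomain R] [AddCommGroup M] [Module R M]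
    [Module.Finite R M] [Module.IsTorsionFree R M] :
    ∃ (ι : Type) (f : M →ₗ[R] (ι → R)), Function.Injective f := by
  classical
  obtain ⟨n, s, hs⟩ := Module.Finite.exists_fin (R := R) (M := M)
  obtain ⟨I, indepI, hI⟩ := exists_maximal_linearIndepOn R s
  let N := Submodule.span R (Set.range fun i : I => s i)
  have exists_a : ∀ i, ∃ a : R, a ≠ 0 ∧ a • s i ∈ N := by
    intro i
    by_cases hi : i ∈ I
    · exact ⟨1, one_ne_zero, by
        rw [one_smul]
        exact Submodule.subset_span (Set.mem_range_self (⟨i, hi⟩ : I))⟩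
    · simpa [Set.image_eq_range s I] using! hI i hi
  choose a ha ha' using exists_a
  let A := ∏ i, a i
  have hA : A ≠ 0 := by
    rw [Finset.prod_ne_zero_iff]
    simpa using! ha
  let φ : M →ₗ[R] M := LinearMap.lsmul R M A
  have hφ : LinearMap.ker φ = ⊥ := LinearMap.ker_lsmul hA
  have hmem : ∀ x, φ x ∈ N := by
    suffices LinearMap.range φ ≤ N from fun x => this ⟨x, rfl⟩
    suffices ∀ i, φ (s i) ∈ N by
      rw [LinearMap.range_eq_map, ← hs, Submodule.map_span_le]
      rintro _ ⟨i, rfl⟩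
      apply this
    intro i
    calc
      (∏ j ∈ {i}ᶜ, a j) • a i • s i ∈ N := N.smul_mem _ (ha' i)
      _ = (∏ j, a j) • s i := by rw [Fintype.prod_eq_prod_compl_mul i, mul_smul]
  let b : Module.Basis I R N := Module.Basis.span indepI
  refine ⟨I, b.equivFun.toLinearMap ∘ₗ φ.codRestrict N hmem, ?_⟩
  rw [LinearMap.coe_comp]
  refine b.equivFun.injective.comp ?_
  rw [← LinearMap.ker_eq_bot, LinearMap.ker_codRestrict, hφ]

variable {K : Type*} [Field K]

/-- The coordinates of an embedding of A into a free S-module. They are recorded as K-linear maps,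
so that they can be tensored over K, with S-linearity kept as a separate property. -/
theorem exists_semilinear_injective_pi {S A : Type*} [CommRing S] [IsDomain S] [CommRing A]
    [Algebra K S] [Algebra K A] (g : S →ₐ[K] A) (hg : g.Finite)
    (htf : ∀ s ≠ 0, ∀ a, g s * a = 0 → a = 0) :
    ∃ (ι : Type) (f : ι → A →ₗ[K] S), (∀ i s a, f i (g s * a) = s * f i a) ∧
      ∀ a, (∀ i, f i a = 0) → a = 0 := by
  let _ : Algebra S A := g.toRingHom.toAlgebra
  have : IsScalarTower K S A := IsScalarTower.of_algebraMap_eq fun x => (g.commutes x).symm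
  have : Module.Finite S A := hg
  have : Module.IsTorsionFree S A := by
    refine ⟨fun r hr => ?_⟩
    rw [isSMulRegular_iff_right_eq_zero_of_smul]
    exact fun a ha => htf r hr.ne_zero a ha
  obtain ⟨ι, f, hf⟩ := exists_injective_pi (R := S) (M := A)
  refine ⟨ι, fun i => (LinearMap.proj i ∘ₗ f).restrictScalars K, fun i s a => ?_, fun a ha => ?_⟩
  · exact congrFun (f.map_smul s a) i
  · exact hf ((funext ha).trans (map_zero f).symm)

theorem tensor_eq_zero_of_forall_rTensor {A B S ι : Type*} [AddCommGroup A] [Module K A]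
    [AddCommGroup B] [Module K B] [AddCommGroup S] [Module K S] (f : ι → A →ₗ[K] S)
    (hf : ∀ a, (∀ i, f i a = 0) → a = 0) (z : A ⊗[K] B)
    (hz : ∀ i, (f i).rTensor B z = 0) : z = 0 := by
  let b := Module.Free.chooseBasis K B
  have key : ∀ i k, TensorProduct.equivFinsuppOfBasisRight b ((f i).rTensor B z) k =
      f i (TensorProduct.equivFinsuppOfBasisRight b z k) := by
    intro i k
    clear hz
    induction z with
    | zero => simp
    | tmul x y => simp
    | add x y hx hy => simp only [map_add, Finsupp.add_apply, hx, hy]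
  apply (TensorProduct.equivFinsuppOfBasisRight b).injective
  ext k
  rw [map_zero, Finsupp.zero_apply]
  apply hf
  intro i
  rw [← key, hz, map_zero, Finsupp.zero_apply]

theorem tensor_eq_zero_of_forall_lTensor {A B S ι : Type*} [AddCommGroup A] [Module K A]
    [AddCommGroup B] [Module K B] [AddCommGroup S] [Module K S] (f : ι → B →ₗ[K] S)
    (hf : ∀ a, (∀ i, f i a = 0) → a = 0) (z : A ⊗[K] B)
    (hz : ∀ i, (f i).lTensor A z = 0) : z = 0 := by
  apply (TensorProduct.comm K A B).injective
  rw [map_zero]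
  refine tensor_eq_zero_of_forall_rTensor f hf _ fun i => ?_
  rw [← LinearMap.comm_comp_lTensor_comp_comm_eq (g := f i)]
  simp [hz]

variable {S T A B : Type*} [CommRing S] [CommRing T] [CommRing A] [CommRing B] [Algebra K S]
  [Algebra K T] [Algebra K A] [Algebra K B]

/-- The maps φ_i ⊗ ψ_j into S ⊗ T are linear over S ⊗ T and jointly injective, so torsion would
already show up in the domain S ⊗ T. -/
theorem tensorMap_torsionFree [IsDomain S] [IsDomain T] [IsDomain (S ⊗[K] T)]
    (g : S →ₐ[K] A) (hg : g.Finite) (h : T →ₐ[K] B) (hh : h.Finite)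
    (hA : ∀ s ≠ 0, ∀ a, g s * a = 0 → a = 0) (hB : ∀ t ≠ 0, ∀ b, h t * b = 0 → b = 0) :
    ∀ u ≠ 0, ∀ z, Algebra.TensorProduct.map g h u * z = 0 → z = 0 := by
  obtain ⟨ι, φ, hφ, hφ'⟩ := exists_semilinear_injective_pi g hg hA
  obtain ⟨κ, ψ, hψ, hψ'⟩ := exists_semilinear_injective_pi h hh hB
  intro u hu z hz
  have key : ∀ i j, TensorProduct.map (φ i) (ψ j) (Algebra.TensorProduct.map g h u * z) =
      u * TensorProduct.map (φ i) (ψ j) z := by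
    intro i j
    clear hz hu
    induction u with
    | zero => simp
    | add x y hx hy => simp only [map_add, add_mul, hx, hy]
    | tmul s t =>
      induction z with
      | zero => simp
      | add x y hx hy => simp only [map_add, mul_add, hx, hy]
      | tmul a b => simp [hφ, hψ]
  apply tensor_eq_zero_of_forall_rTensor φ hφ'
  intro i
  apply tensor_eq_zero_of_forall_lTensor ψ hψ'
  intro j
  have := key i j
  rw [hz, map_zero, eq_comm, mul_eq_zero, or_iff_right hu] at this
  rwa [← LinearMap.comp_apply, LinearMap.lTensor_comp_rTensor]

/-- Over a field both factors embed in the tensor product, so a relation in A becomes one between s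
⊗ 1 and a ⊗ 1. -/
theorem torsionFree_of_tensorMap [Nontrivial B] (g : S →ₐ[K] A) (h : T →ₐ[K] B)
    (hAB : ∀ u ≠ 0, ∀ z, Algebra.TensorProduct.map g h u * z = 0 → z = 0) [Nontrivial T] :
    ∀ s ≠ 0, ∀ a, g s * a = 0 → a = 0 := by
  intro s hs a ha
  have h1 : (s ⊗ₜ[K] (1 : T)) ≠ 0 := by
    intro h0
    apply hs
    apply Algebra.TensorProduct.includeLeft_injective (R := K) (S := K) (A := S) (B := T)
      (algebraMap K T).injective
    simpa using h0
  have h2 := hAB _ h1 (a ⊗ₜ 1) (by simp [ha])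
  apply Algebra.TensorProduct.includeLeft_injective (R := K) (S := K) (A := A) (B := B)
      (algebraMap K B).injective
  simpa using h2

theorem isIntegralElem_of_comm {S S' A A' : Type*} [CommRing S] [CommRing S'] [Ring A] [Ring A']
    (g : S →+* A) (g' : S' →+* A') (i : S →+* S') (j : A →+* A') (hc : ∀ x, g' (i x) = j (g x))
    {a : A} (ha : g.IsIntegralElem a) : g'.IsIntegralElem (j a) := by
  obtain ⟨p, hp, h0⟩ := ha
  refine ⟨p.map i, hp.map _, ?_⟩
  rw [Polynomial.eval₂_map, show g'.comp i = j.comp g from RingHom.ext hc, ← Polynomial.hom_eval₂,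
    h0, map_zero]

theorem tensorMap_isIntegral (g : S →ₐ[K] A) (hg : g.toRingHom.IsIntegral) (h : T →ₐ[K] B)
    (hh : h.toRingHom.IsIntegral) :
    (Algebra.TensorProduct.map g h).toRingHom.IsIntegral := by
  intro z
  induction z with
  | zero => exact RingHom.isIntegralElem_zero _
  | add x y hx hy => exact hx.add _ hy
  | tmul a b =>
    have : a ⊗ₜ[K] b = (a ⊗ₜ 1) * (1 ⊗ₜ b) := by simp
    rw [this]
    refine RingHom.IsIntegralElem.mul _ ?_ ?_
    · exact isIntegralElem_of_comm g.toRingHom _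
        (Algebra.TensorProduct.includeLeft : S →ₐ[K] S ⊗[K] T).toRingHom
        (Algebra.TensorProduct.includeLeft : A →ₐ[K] A ⊗[K] B).toRingHom
        (fun x => by simp) (hg a)
    · exact isIntegralElem_of_comm h.toRingHom _
        (Algebra.TensorProduct.includeRight : T →ₐ[K] S ⊗[K] T).toRingHom
        (Algebra.TensorProduct.includeRight : B →ₐ[K] A ⊗[K] B).toRingHom
        (fun x => by simp) (hh b)

end Tensor

/-! ### Unmixedness of a join -/

section Unmixed

variable {K : Type*} [Field K]

theorem isUnmixed_top {R : Type*} [CommRing R] : IsUnmixed (⊤ : Ideal R) := by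
  intro P hP
  have : Subsingleton (R ⧸ (⊤ : Ideal R)) := Ideal.Quotient.subsingleton_iff.mpr rfl
  exact (not_isAssociatedPrime_of_subsingleton hP).elim

instance finiteRingKrullDim_mvPolynomial {ι : Type*} [Finite ι] :
    FiniteRingKrullDim (MvPolynomial ι K) := by
  rw [finiteRingKrullDim_iff_ne_bot_and_top, MvPolynomial.ringKrullDim_of_isNoetherianRing,
    ringKrullDim_eq_zero_of_field, zero_add]
  exact ⟨WithBot.coe_ne_bot, fun h => ENat.natCast_ne_top _ (WithBot.coe_injective h)⟩

variable {σ τ ρ : Type*} [Finite σ] [Finite τ] [Finite ρ]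

/-- The tensor product of Noether normalizations of the two quotients is a polynomial ring over
which the quotient by the join is integral, so the torsion criterion applies to all three ideals at
once. -/
theorem isUnmixed_join_iff (e : σ ⊕ τ ≃ ρ) {I : Ideal (MvPolynomial σ K)}
    {J : Ideal (MvPolynomial τ K)} (hI : I ≠ ⊤) (hJ : J ≠ ⊤) :
    IsUnmixed (join e I J) ↔ IsUnmixed I ∧ IsUnmixed J := by
  have : Nontrivial (MvPolynomial σ K ⧸ I) := Ideal.Quotient.nontrivial_iff.mpr hI
  have : Nontrivial (MvPolynomial τ K ⧸ J) := Ideal.Quotient.nontrivial_iff.mpr hJ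
  obtain ⟨s, g, hg, hgf⟩ := exists_finite_inj_algHom_of_fg K (MvPolynomial σ K ⧸ I)
  obtain ⟨t, h, hh, hhf⟩ := exists_finite_inj_algHom_of_fg K (MvPolynomial τ K ⧸ J)
  have hgi : g.toRingHom.IsIntegral := RingHom.Finite.to_isIntegral hgf
  have hhi : h.toRingHom.IsIntegral := RingHom.Finite.to_isIntegral hhf
  let E := tensorEquivSum K (Fin s) (Fin t) K
  have : IsDomain (MvPolynomial (Fin s) K ⊗[K] MvPolynomial (Fin t) K) :=
    E.toRingEquiv.isDomain_iff.mpr inferInstance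
  have : FiniteRingKrullDim (MvPolynomial (Fin s) K ⊗[K] MvPolynomial (Fin t) K) := by
    rw [finiteRingKrullDim_iff_ne_bot_and_top, ringKrullDim_eq_of_ringEquiv E.toRingEquiv]
    exact ⟨ringKrullDim_ne_bot, ringKrullDim_ne_top⟩
  let π : MvPolynomial ρ K →ₐ[K] (MvPolynomial σ K ⧸ I) ⊗[K] (MvPolynomial τ K ⧸ J) :=
    (Algebra.TensorProduct.map (Ideal.Quotient.mkₐ K I) (Ideal.Quotient.mkₐ K J)).comp
      (splitEquiv K e).symm.toAlgHom
  have hπ : Function.Surjective π :=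
    (TensorProduct.map_surjective (Ideal.Quotient.mkₐ_surjective K I)
      (Ideal.Quotient.mkₐ_surjective K J)).comp (splitEquiv K e).symm.surjective
  have hker : RingHom.ker π.toRingHom = join e I J := by
    ext f
    exact (mem_join_iff_tensorMap e I J f).symm
  let Q : (MvPolynomial ρ K ⧸ join e I J) ≃+*
      (MvPolynomial σ K ⧸ I) ⊗[K] (MvPolynomial τ K ⧸ J) :=
    (Ideal.quotEquivOfEq hker.symm).trans (RingHom.quotientKerEquivOfSurjective (f := π.toRingHom) hπ)
  have hinj : Function.Injective (Algebra.TensorProduct.map g h) :=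
    TensorProduct.map_injective_of_flat_flat g.toLinearMap h.toLinearMap hg hh
  let G : MvPolynomial (Fin s) K ⊗[K] MvPolynomial (Fin t) K →+* MvPolynomial ρ K ⧸ join e I J :=
    Q.symm.toRingHom.comp (Algebra.TensorProduct.map g h).toRingHom
  rw [isUnmixed_iff I g.toRingHom hg hgi, isUnmixed_iff J h.toRingHom hh hhi,
    isUnmixed_iff (join e I J) G (Q.symm.injective.comp hinj)
      ((tensorMap_isIntegral g hgi h hhi).trans _ _
        (RingHom.isIntegral_of_surjective _ Q.symm.surjective))]
  have hQ : (∀ u ≠ 0, ∀ a, G u * a = 0 → a = 0) ↔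
      ∀ u ≠ 0, ∀ z, Algebra.TensorProduct.map g h u * z = 0 → z = 0 := by
    refine forall₂_congr fun u hu => ⟨fun H z hz => ?_, fun H a ha => ?_⟩
    · apply Q.symm.injective
      rw [map_zero]
      apply H
      change Q.symm (Algebra.TensorProduct.map g h u) * Q.symm z = 0
      rw [← map_mul, hz, map_zero]
    · apply Q.injective
      rw [map_zero]
      apply H
      apply Q.symm.injective
      rw [map_mul, Q.symm_apply_apply, map_zero]
      exact ha
  rw [hQ]
  constructor
  · intro H
    refine ⟨torsionFree_of_tensorMap g h H, torsionFree_of_tensorMap h g fun u hu z hz => ?_⟩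
    apply (Algebra.TensorProduct.comm K _ _).injective
    rw [map_zero]
    refine H (Algebra.TensorProduct.comm K _ _ u) (by simpa using hu) _ ?_
    rw [← map_zero (Algebra.TensorProduct.comm K _ _), ← hz, map_mul]
    congr 1
    clear hu hz
    induction u with
    | zero => simp
    | tmul x y => simp
    | add x y hx hy => simp only [map_add, hx, hy]
  · rintro ⟨hA, hB⟩
    exact tensorMap_torsionFree g hgf h hhf hA hB

end Unmixed

/-! ### Polynomials in one distinguished variable and ideals of leading coefficients -/

section Univariate

variable {K : Type*} [Field K] {σ : Type*}

/-- `K[σ]` as the ring of univariate polynomials in `y` over `K[σ ∖ y]`. -/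
def toPoly (K : Type*) [Field K] (y : σ) :
    MvPolynomial σ K ≃ₐ[K] Polynomial (MvPolynomial {x : σ // x ≠ y} K) :=
  letI : DecidableEq σ := Classical.decEq σ
  (renameEquiv K (Equiv.optionSubtypeNe y).symm).trans (optionEquivLeft K _)

theorem toPoly_X_self (y : σ) : toPoly K y (X y) = Polynomial.X := by
  simp [toPoly]

theorem toPoly_rename_val (y : σ) (a : MvPolynomial {x : σ // x ≠ y} K) :
    toPoly K y (rename Subtype.val a) = Polynomial.C a := by
  suffices (toPoly K y).toAlgHom.comp (rename Subtype.val) =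
      (Polynomial.CAlgHom : _ →ₐ[K] Polynomial (MvPolynomial {x : σ // x ≠ y} K)) from
    DFunLike.congr_fun this a
  ext x : 1
  let _ : DecidableEq σ := Classical.decEq σ
  have hx : (Equiv.optionSubtypeNe y).symm x = some x := Equiv.optionSubtypeNe_symm_of_ne x.2
  simp only [toPoly, AlgHom.comp_apply, AlgEquiv.coe_toAlgHom, AlgEquiv.trans_apply, rename_X,
    renameEquiv_apply]
  rw [hx, optionEquivLeft_X_some]
  rfl

theorem toPoly_symm_C (y : σ) (a : MvPolynomial {x : σ // x ≠ y} K) :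
    (toPoly K y).symm (Polynomial.C a) = rename Subtype.val a := by
  rw [← toPoly_rename_val, AlgEquiv.symm_apply_apply]

theorem natDegree_toPoly (y : σ) (f : MvPolynomial σ K) :
    (toPoly K y f).natDegree = f.degreeOf y := by
  classical
  rw [degreeOf_eq_natDegree, toPoly]
  simp only [AlgEquiv.trans_apply, renameEquiv_apply]

theorem monomial_eq_rename_mul (y : σ) (m : σ →₀ ℕ) (c : K) :
    monomial m c =
      rename Subtype.val (monomial (m.subtypeDomain fun x => x ≠ y) c) * X y ^ m y := by
  rw [rename_monomial, X_pow_eq_monomial, monomial_mul, mul_one]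
  refine congrArg (fun s => monomial s c) (Finsupp.ext fun x => ?_)
  by_cases h : x = y
  · subst h
    rw [Finsupp.add_apply, Finsupp.mapDomain_of_notMem_range _ _ (by simp)]
    simp
  · have := Finsupp.mapDomain_apply Subtype.val_injective (m.subtypeDomain fun x => x ≠ y) ⟨x, h⟩
    rw [Finsupp.add_apply]
    simp only at this
    rw [this]
    simp [Ne.symm h]

theorem toPoly_monomial (y : σ) (m : σ →₀ ℕ) (c : K) :
    toPoly K y (monomial m c) =
      Polynomial.monomial (m y) (monomial (m.subtypeDomain fun x => x ≠ y) c) := by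
  rw [monomial_eq_rename_mul y, map_mul, map_pow, toPoly_rename_val, toPoly_X_self,
    Polynomial.C_mul_X_pow_eq_monomial]

theorem coeff_toPoly (y : σ) (f : MvPolynomial σ K) (n : ℕ) :
    (toPoly K y f).coeff n = ∑ m ∈ f.support with m y = n,
      monomial (m.subtypeDomain fun x => x ≠ y) (f.coeff m) := by
  conv_lhs => rw [f.as_sum]
  rw [map_sum, Polynomial.finsetSum_coeff, Finset.sum_filter]
  refine Finset.sum_congr rfl fun m _ => ?_
  rw [toPoly_monomial, Polynomial.coeff_monomial]

theorem topCoeff_eq (y : σ) (f : MvPolynomial σ K) :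
    topCoeff y f = rename Subtype.val (toPoly K y f).leadingCoeff := by
  rw [Polynomial.leadingCoeff, natDegree_toPoly, coeff_toPoly, map_sum, topCoeff]
  refine Finset.sum_congr rfl fun m _ => ?_
  have := monomial_eq_rename_mul y (m.erase y) (f.coeff m)
  rw [Finsupp.erase_same, pow_zero, mul_one] at this
  rw [this]
  refine congrArg (fun s => rename Subtype.val (monomial s _)) (Finsupp.ext fun x => ?_)
  simp [Finsupp.erase_ne x.2]

theorem toPoly_initForm (y : σ) (f : MvPolynomial σ K) :
    toPoly K y (initForm y f) =
      Polynomial.monomial (f.degreeOf y) (toPoly K y f).leadingCoeff := by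
  rw [initForm, topCoeff_eq, map_mul, map_pow, toPoly_X_self, toPoly_rename_val, mul_comm,
    Polynomial.C_mul_X_pow_eq_monomial]

/-- An ideal of `K[σ]` viewed in the ring of univariate polynomials in `y`. -/
def polyIdeal (y : σ) (I : Ideal (MvPolynomial σ K)) :
    Ideal (Polynomial (MvPolynomial {x : σ // x ≠ y} K)) :=
  I.comap (toPoly K y).symm

theorem mem_polyIdeal {y : σ} {I : Ideal (MvPolynomial σ K)}
    {p : Polynomial (MvPolynomial {x : σ // x ≠ y} K)} :
    p ∈ polyIdeal y I ↔ (toPoly K y).symm p ∈ I := Iff.rfl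

theorem toPoly_mem_polyIdeal {y : σ} {I : Ideal (MvPolynomial σ K)} {f : MvPolynomial σ K} :
    toPoly K y f ∈ polyIdeal y I ↔ f ∈ I := by
  rw [mem_polyIdeal, AlgEquiv.symm_apply_apply]

theorem mem_map_rename_val_iff (y : σ) (L : Ideal (MvPolynomial {x : σ // x ≠ y} K))
    (f : MvPolynomial σ K) :
    f ∈ L.map (rename (R := K) Subtype.val) ↔ ∀ n, (toPoly K y f).coeff n ∈ L := by
  rw [← Ideal.mem_map_C_iff]
  constructor
  · intro h
    have := Ideal.mem_map_of_mem (toPoly K y).toAlgHom h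
    rw [Ideal.map_mapₐ] at this
    have hc : (toPoly K y).toAlgHom.comp (rename Subtype.val) =
        (Polynomial.CAlgHom : _ →ₐ[K] Polynomial (MvPolynomial {x : σ // x ≠ y} K)) :=
      AlgHom.ext (toPoly_rename_val y)
    rw [hc] at this
    exact this
  · intro h
    have := Ideal.mem_map_of_mem (toPoly K y).symm.toRingHom h
    rw [Ideal.map_map] at this
    have hc : (toPoly K y).symm.toRingHom.comp Polynomial.C =
        (rename (R := K) (Subtype.val : {x : σ // x ≠ y} → σ)).toRingHom :=
      RingHom.ext (toPoly_symm_C y)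
    rw [hc] at this
    have h2 : (toPoly K y).symm.toRingHom (toPoly K y f) = f :=
      (toPoly K y).symm_apply_apply f
    rwa [h2] at this

theorem contract_map_rename_val (y : σ) (L : Ideal (MvPolynomial {x : σ // x ≠ y} K)) :
    contract y (L.map (rename (R := K) Subtype.val)) = L := by
  ext a
  rw [contract, Ideal.mem_comap, mem_map_rename_val_iff, toPoly_rename_val]
  refine ⟨fun h => by simpa using h 0, fun h n => ?_⟩
  rw [Polynomial.coeff_C]
  split_ifs
  exacts [h, L.zero_mem]

theorem mem_map_rename_val_sup_iff (y : σ) (N : Ideal (MvPolynomial {x : σ // x ≠ y} K))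
    (f : MvPolynomial σ K) :
    f ∈ N.map (rename (R := K) Subtype.val) ⊔ Ideal.span {X y} ↔
      (toPoly K y f).coeff 0 ∈ N := by
  constructor
  · intro h
    have hle : N.map (rename (R := K) Subtype.val) ⊔ Ideal.span {X y} ≤
        N.comap (Polynomial.constantCoeff.comp (toPoly K y).toRingHom) := by
      rw [sup_le_iff, Ideal.map_le_iff_le_comap, Ideal.span_singleton_le_iff_mem]
      refine ⟨fun a ha => ?_, ?_⟩
      · change (toPoly K y (rename Subtype.val a)).coeff 0 ∈ N
        simpa [toPoly_rename_val] using ha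
      · change (toPoly K y (X y)).coeff 0 ∈ N
        simp [toPoly_X_self]
    exact hle h
  · intro h
    have hf : f = X y * (toPoly K y).symm (toPoly K y f).divX +
        rename Subtype.val ((toPoly K y f).coeff 0) := by
      apply (toPoly K y).injective
      rw [map_add, map_mul, toPoly_X_self, toPoly_rename_val, AlgEquiv.apply_symm_apply,
        Polynomial.X_mul_divX_add]
    rw [hf]
    exact add_mem (Ideal.mem_sup_right (Ideal.mul_mem_right _ _ (Ideal.mem_span_singleton_self _)))
      (Ideal.mem_sup_left (Ideal.mem_map_of_mem _ h))

/-- The ideal of initial forms is homogeneous for the grading by the power of `y`, so it is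
determined degree by degree. -/
theorem mem_initFormIdeal_iff (y : σ) (I : Ideal (MvPolynomial σ K)) (f : MvPolynomial σ K) :
    f ∈ initFormIdeal y I ↔ ∀ n, (toPoly K y f).coeff n ∈ (polyIdeal y I).leadingCoeffNth n := by
  constructor
  · intro h
    induction h using Submodule.span_induction with
    | zero => simp
    | add f g _ _ hf hg =>
      intro n
      rw [map_add, Polynomial.coeff_add]
      exact add_mem (hf n) (hg n)
    | smul a f _ hf =>
      intro n
      rw [smul_eq_mul, map_mul, Polynomial.coeff_mul]
      refine sum_mem fun c hc => Ideal.mul_mem_left _ _ ?_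
      exact Ideal.leadingCoeffNth_mono _ (Finset.HasAntidiagonal.mem_antidiagonal.mp hc ▸
        Nat.le_add_left _ _) (hf c.2)
    | mem f hf =>
      obtain ⟨g, hg, rfl⟩ := hf
      intro n
      rw [toPoly_initForm, Polynomial.coeff_monomial]
      split_ifs with hn
      · rw [Ideal.mem_leadingCoeffNth]
        refine ⟨toPoly K y g, toPoly_mem_polyIdeal.mpr hg, ?_, rfl⟩
        rw [← hn, ← natDegree_toPoly]
        exact Polynomial.degree_le_natDegree
      · exact zero_mem _
  · intro h
    have hf : f = ∑ n ∈ (toPoly K y f).support,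
        (toPoly K y).symm (Polynomial.monomial n ((toPoly K y f).coeff n)) := by
      rw [← map_sum, ← Polynomial.as_sum_support, AlgEquiv.symm_apply_apply]
    rw [hf]
    refine sum_mem fun n _ => ?_
    obtain ⟨p, hp, hpn, hpc⟩ := (Ideal.mem_leadingCoeffNth _ _ _).mp (h n)
    have hle : p.natDegree ≤ n := Polynomial.natDegree_le_of_degree_le hpn
    -- An element of degree below n still serves after its initial form is multiplied by the missing
    -- power of `y`.
    have : (toPoly K y).symm (Polynomial.monomial n ((toPoly K y f).coeff n)) =
        X y ^ (n - p.natDegree) * initForm y ((toPoly K y).symm p) := by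
      apply (toPoly K y).injective
      rw [map_mul, map_pow, toPoly_X_self, toPoly_initForm, AlgEquiv.apply_symm_apply,
        ← natDegree_toPoly, AlgEquiv.apply_symm_apply, hpc, Polynomial.X_pow_mul_monomial,
        Nat.add_sub_cancel' hle]
    rw [this]
    exact Ideal.mul_mem_left _ _ (Ideal.subset_span ⟨_, hp, rfl⟩)

/-- In degree 0 both sides have the same component. In each degree n ≥ 1 the right side has the full
leading coefficient ideal and the left side its n-th stage; as the stages increase with n, equality
in degree 1 forces the rest. -/
theorem initFormIdeal_eq_iff (y : σ) (I : Ideal (MvPolynomial σ K)) :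
    initFormIdeal y I = (polyIdeal y I).leadingCoeff.map (rename (R := K) Subtype.val) ⊓
        (((polyIdeal y I).comap Polynomial.C).map (rename (R := K) Subtype.val) ⊔
          Ideal.span {X y}) ↔
      (polyIdeal y I).leadingCoeff ≤ (polyIdeal y I).leadingCoeffNth 1 := by
  constructor
  · intro h x hx
    -- The test element is x·y: its constant coefficient vanishes, so the condition coming from N is
    -- empty.
    have hmem : (toPoly K y).symm (Polynomial.monomial 1 x) ∈ initFormIdeal y I := by
      rw [h, Ideal.mem_inf, mem_map_rename_val_iff, mem_map_rename_val_sup_iff,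
        AlgEquiv.apply_symm_apply]
      refine ⟨fun n => ?_, by simp [Polynomial.coeff_monomial]⟩
      rw [Polynomial.coeff_monomial]
      split_ifs
      exacts [hx, zero_mem _]
    rw [mem_initFormIdeal_iff, AlgEquiv.apply_symm_apply] at hmem
    simpa using hmem 1
  · intro h
    ext f
    rw [Ideal.mem_inf, mem_map_rename_val_iff, mem_map_rename_val_sup_iff, mem_initFormIdeal_iff]
    constructor
    · intro H
      refine ⟨fun n => ?_, (Ideal.mem_leadingCoeffNth_zero _ _).mp (H 0)⟩
      exact le_iSup (polyIdeal y I).leadingCoeffNth n (H n)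
    · rintro ⟨H, H0⟩ n
      rcases Nat.eq_zero_or_pos n with rfl | hn
      · exact (Ideal.mem_leadingCoeffNth_zero _ _).mpr H0
      · exact Ideal.leadingCoeffNth_mono _ hn (h (H n))

end Univariate

/-! ### Compatible orders and division by a Gröbner basis -/

section Groebner

variable {K : Type*} [Field K] {σ : Type*} {m : MonomialOrder σ} {y : σ}

theorem IsCompatible.apply_le_apply (hm : IsCompatible K m y) {a b : σ →₀ ℕ}
    (h : m.toSyn a ≤ m.toSyn b) : a y ≤ b y := by
  classical
  by_contra! hlt
  have hab : a ≠ b := by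
    rintro rfl
    exact hlt.ne rfl
  have hs : m.toSyn a < m.toSyn b := lt_of_le_of_ne h fun h' => hab (m.toSyn.injective h')
  -- Compatibility is tested on the sum of the two monomials: its initial form selects a by
  -- `y`-degree, while the order selects b.
  have hinit : initForm y (monomial a (1 : K) + monomial b 1) = monomial a 1 := by
    apply (toPoly K y).injective
    have hdeg : (Polynomial.monomial (b y)
        (monomial (b.subtypeDomain fun x => x ≠ y) (1 : K))).natDegree <
        (Polynomial.monomial (a y)
        (monomial (a.subtypeDomain fun x => x ≠ y) (1 : K))).natDegree := by
      rwa [Polynomial.natDegree_monomial_eq _ (by simp), Polynomial.natDegree_monomial_eq _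
        (by simp)]
    rw [toPoly_initForm, ← natDegree_toPoly, map_add, toPoly_monomial, toPoly_monomial,
      Polynomial.leadingCoeff_add_of_degree_lt' (Polynomial.degree_lt_degree hdeg),
      Polynomial.natDegree_add_eq_left_of_natDegree_lt hdeg, Polynomial.leadingCoeff_monomial,
      Polynomial.natDegree_monomial_eq _ (by simp)]
  have hd : m.degree (monomial a (1 : K) + monomial b 1) = b := by
    rw [m.degree_add_eq_right_of_lt] <;> simp [MonomialOrder.degree_monomial, hs]
  have := hm (monomial a 1 + monomial b 1)
  rw [hinit, MonomialOrder.leadingTerm_eq_leadingTerm_iff, hd, MonomialOrder.degree_monomial] at this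
  simp at this
  exact hab this.2.symm

theorem IsCompatible.degree_apply (hm : IsCompatible K m y) {f : MvPolynomial σ K} (hf : f ≠ 0) :
    m.degree f y = f.degreeOf y := by
  classical
  apply le_antisymm
  · rw [degreeOf_eq_sup]
    exact Finset.le_sup (f := fun m : σ →₀ ℕ => m y) (m.degree_mem_support hf)
  · rw [degreeOf_le_iff]
    exact fun s hs => hm.apply_le_apply (m.le_degree hs)

theorem IsGroebnerBasis.exists_degree_le_of_mem_initIdeal {I : Ideal (MvPolynomial σ K)}
    {B : Finset (MvPolynomial σ K)} (hB : IsGroebnerBasis m I B) {p : MvPolynomial σ K}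
    (hp : p ∈ initIdeal m I) : ∀ c ∈ p.support, ∃ b ∈ B, m.degree b ≤ c := by
  classical
  rw [← hB.span_eq] at hp
  induction hp using Submodule.span_induction with
  | zero => simp
  | add f g _ _ hf hg =>
    intro c hc
    rcases Finset.mem_union.mp (support_add hc) with h | h
    exacts [hf c h, hg c h]
  | smul a f _ hf =>
    intro c hc
    obtain ⟨u, -, v, hv, rfl⟩ := Finset.mem_add.mp (support_mul _ _ hc)
    obtain ⟨b, hb, hle⟩ := hf v hv
    exact ⟨b, hb, hle.trans le_add_self⟩
  | mem f hf =>
    obtain ⟨b, hb, rfl⟩ := hf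
    intro c hc
    rw [MonomialOrder.support_leadingTerm' (hB.ne_zero b hb), Finset.mem_singleton] at hc
    exact ⟨b, hb, hc.ge⟩

/-- Division by a Gröbner basis leaves no remainder and bounds each summand in the monomial order;
compatibility turns this into a bound on `y`-degrees. -/
theorem IsGroebnerBasis.exists_representation (hm : IsCompatible K m y)
    {I : Ideal (MvPolynomial σ K)} {B : Finset (MvPolynomial σ K)} (hB : IsGroebnerBasis m I B)
    {f : MvPolynomial σ K} (hf : f ∈ I) :
    ∃ g : MvPolynomial σ K → MvPolynomial σ K, f = ∑ b ∈ B, b * g b ∧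
      ∀ b ∈ B, (b * g b).degreeOf y ≤ f.degreeOf y := by
  classical
  rcases eq_or_ne f 0 with rfl | hf0
  · exact ⟨0, by simp, by simp⟩
  obtain ⟨g, r, hfr, hdeg, hr⟩ := m.div_set (B := (B : Set (MvPolynomial σ K)))
    (fun b hb => MonomialOrder.isUnit_leadingCoeff.mpr (hB.ne_zero b hb)) f
  have hsum : Finsupp.linearCombination (MvPolynomial σ K)
      (fun b : (B : Set (MvPolynomial σ K)) => (b : MvPolynomial σ K)) g =
      ∑ b ∈ B.attach, (b : MvPolynomial σ K) * g b := by
    rw [Finsupp.linearCombination_apply, Finsupp.sum_fintype _ _ (by simp)]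
    rw [← Finset.univ_eq_attach]
    refine Finset.sum_congr (by ext; simp) fun b _ => by simp [mul_comm]
  have hr0 : r = 0 := by
    by_contra h0
    have hrI : r ∈ I := by
      have : r = f - ∑ b ∈ B.attach, (b : MvPolynomial σ K) * g b := by
        rw [← hsum, hfr]; ring
      rw [this]
      exact sub_mem hf (sum_mem fun b _ => Ideal.mul_mem_right _ _ (hB.subset b.2))
    obtain ⟨b, hb, hle⟩ := hB.exists_degree_le_of_mem_initIdeal
      (Ideal.subset_span ⟨r, hrI, rfl⟩ : m.leadingTerm r ∈ initIdeal m I) (m.degree r)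
      (by rw [MonomialOrder.support_leadingTerm' h0]; simp)
    exact hr _ (m.degree_mem_support h0) b hb hle
  rw [hr0, add_zero, hsum] at hfr
  refine ⟨fun b => if hb : b ∈ B then g ⟨b, hb⟩ else 0, ?_, ?_⟩
  · conv_lhs => rw [hfr]
    rw [← Finset.sum_attach B]
    refine Finset.sum_congr rfl fun b _ => by simp
  · intro b hb
    simp only [dif_pos hb]
    by_cases h0 : b * g ⟨b, hb⟩ = 0
    · simp [h0]
    rw [← hm.degree_apply h0, ← hm.degree_apply hf0]
    exact hm.apply_le_apply (hdeg ⟨b, hb⟩)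

end Groebner

/-! ### C and N as extensions of leading coefficient ideals -/

section Intrinsic

variable {K : Type*} [Field K] {σ : Type*} {m : MonomialOrder σ} {y : σ}

theorem comap_C_polyIdeal (y : σ) (I : Ideal (MvPolynomial σ K)) :
    (polyIdeal y I).comap Polynomial.C = (polyIdeal y I).leadingCoeffNth 0 := by
  ext x
  rw [Ideal.mem_leadingCoeffNth_zero, Ideal.mem_comap]

/-- In a degree-bounded representation of f, only the summands of the same `y`-degree as f
contribute to its leading coefficient, and leading coefficients are multiplicative. -/
theorem IsGroebnerBasis.idealC_eq (hm : IsCompatible K m y) {I : Ideal (MvPolynomial σ K)}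
    {B : Finset (MvPolynomial σ K)} (hB : IsGroebnerBasis m I B) :
    idealC y B = (polyIdeal y I).leadingCoeff.map (rename (R := K) Subtype.val) := by
  apply le_antisymm
  · rw [idealC, Ideal.span_le]
    rintro _ ⟨g, hg, rfl⟩
    rw [topCoeff_eq]
    refine Ideal.mem_map_of_mem _ ((Ideal.mem_leadingCoeff _ _).mpr ⟨_, ?_, rfl⟩)
    exact toPoly_mem_polyIdeal.mpr (hB.subset hg)
  · rw [Ideal.map_le_iff_le_comap]
    intro x hx
    obtain ⟨p, hp, rfl⟩ := (Ideal.mem_leadingCoeff _ _).mp hx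
    obtain ⟨f, rfl⟩ := (toPoly K y).surjective p
    obtain ⟨g, hfg, hdeg⟩ := hB.exists_representation hm (toPoly_mem_polyIdeal.mp hp)
    rw [Ideal.mem_comap, Polynomial.leadingCoeff, natDegree_toPoly]
    have hf : toPoly K y f = ∑ b ∈ B, toPoly K y (b * g b) := by
      rw [← map_sum, ← hfg]
    rw [hf, Polynomial.finsetSum_coeff, map_sum]
    refine sum_mem fun b hb => ?_
    have hd := hdeg b hb
    rcases hd.lt_or_eq with hlt | heq
    · rw [← natDegree_toPoly] at hlt
      rw [Polynomial.coeff_eq_zero_of_natDegree_lt hlt, map_zero]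
      exact zero_mem _
    · rw [← heq, ← natDegree_toPoly, ← Polynomial.leadingCoeff, map_mul,
        Polynomial.leadingCoeff_mul, map_mul, ← topCoeff_eq]
      exact Ideal.mul_mem_right _ _ (Ideal.subset_span ⟨b, hb, rfl⟩)

theorem topCoeff_eq_self {f : MvPolynomial σ K} (hf : f.degreeOf y = 0) : topCoeff y f = f := by
  apply (toPoly K y).injective
  rw [topCoeff_eq, toPoly_rename_val]
  rw [← natDegree_toPoly] at hf
  rw [Polynomial.leadingCoeff, hf, ← Polynomial.eq_C_of_natDegree_eq_zero hf]

/-- When f is free of `y`, the degree bound makes every nonzero summand free of `y`, hence also the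
basis element in it. -/
theorem IsGroebnerBasis.idealN_eq (hm : IsCompatible K m y) {I : Ideal (MvPolynomial σ K)}
    {B : Finset (MvPolynomial σ K)} (hB : IsGroebnerBasis m I B) :
    idealN y B = ((polyIdeal y I).leadingCoeffNth 0).map (rename (R := K) Subtype.val) := by
  apply le_antisymm
  · rw [idealN, Ideal.span_le]
    rintro _ ⟨g, ⟨hg, hgy⟩, rfl⟩
    rw [topCoeff_eq]
    refine Ideal.mem_map_of_mem _ ((Ideal.mem_leadingCoeffNth _ _ _).mpr ⟨_, ?_, ?_, rfl⟩)
    · exact toPoly_mem_polyIdeal.mpr (hB.subset hg)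
    · rw [← natDegree_toPoly] at hgy
      exact Polynomial.degree_le_of_natDegree_le hgy.le
  · rw [Ideal.map_le_iff_le_comap]
    intro x hx
    rw [Ideal.mem_leadingCoeffNth_zero, mem_polyIdeal, toPoly_symm_C] at hx
    rw [Ideal.mem_comap]
    obtain ⟨g, hfg, hdeg⟩ := hB.exists_representation hm hx
    rw [← natDegree_toPoly, toPoly_rename_val, Polynomial.natDegree_C] at hdeg
    rw [hfg]
    refine sum_mem fun b hb => ?_
    by_cases h0 : b * g b = 0
    · rw [h0]
      exact zero_mem _
    have hd := hdeg b hb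
    rw [← natDegree_toPoly, map_mul, Polynomial.natDegree_mul, natDegree_toPoly] at hd
    · have hb0 : b.degreeOf y = 0 := by omega
      refine Ideal.mul_mem_right _ _ (Ideal.subset_span ⟨b, ⟨hb, hb0⟩, topCoeff_eq_self hb0⟩)
    · simpa using left_ne_zero_of_mul h0
    · simpa using right_ne_zero_of_mul h0

theorem initForm_eq_sum (y : σ) (f : MvPolynomial σ K) :
    initForm y f = ∑ m ∈ f.support with m y = f.degreeOf y, monomial m (f.coeff m) := by
  rw [initForm, topCoeff, Finset.mul_sum]
  refine Finset.sum_congr rfl fun m hm => ?_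
  rw [X_pow_eq_monomial, monomial_mul, one_mul, ← (Finset.mem_filter.mp hm).2,
    Finsupp.single_add_erase]

theorem coeff_initForm [DecidableEq σ] (y : σ) (f : MvPolynomial σ K) (c : σ →₀ ℕ) :
    (initForm y f).coeff c = if c y = f.degreeOf y then f.coeff c else 0 := by
  rw [initForm_eq_sum, coeff_sum, Finset.sum_filter]
  simp only [coeff_monomial]
  rw [Finset.sum_eq_single c]
  · simp
  · intro b _ hbc
    simp [hbc]
  · intro hc
    rw [notMem_support_iff] at hc
    simp [hc]

/-- The leading monomial of f has the largest `y`-degree, so it survives in the initial form, whose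
support lies in that of f. -/
theorem isCompatible_of_apply_le_apply
    (h : ∀ a b, m.toSyn a ≤ m.toSyn b → a y ≤ b y) : IsCompatible K m y := by
  classical
  intro f
  rcases eq_or_ne f 0 with rfl | hf
  · simp [initForm, topCoeff]
  have hy : m.degree f y = f.degreeOf y := by
    apply le_antisymm
    · rw [degreeOf_eq_sup]
      exact Finset.le_sup (f := fun m : σ →₀ ℕ => m y) (m.degree_mem_support hf)
    · rw [degreeOf_le_iff]
      exact fun s hs => h _ _ (m.le_degree hs)
  have hc : (initForm y f).coeff (m.degree f) = f.coeff (m.degree f) := by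
    rw [coeff_initForm, if_pos hy]
  have hdeg : m.degree (initForm y f) = m.degree f := by
    apply m.toSyn.injective
    apply le_antisymm
    · apply MonomialOrder.degree_le_degree_of_support_subset
      intro c
      rw [mem_support_iff, mem_support_iff, coeff_initForm]
      split_ifs <;> simp
    · apply MonomialOrder.le_degree
      rw [mem_support_iff, hc]
      exact MonomialOrder.coeff_degree_ne_zero_iff.mpr hf
  rw [MonomialOrder.leadingTerm, MonomialOrder.leadingTerm, hdeg, MonomialOrder.leadingCoeff,
    MonomialOrder.leadingCoeff, hdeg, hc]

end Intrinsic

/-! ### Existence of compatible orders and Gröbner bases, and the order-free form of the recursion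
-/

section Existence

/-- Transport of a monomial order along a bijection of the variables. -/
def monomialOrderCongr {σ : Type u} {τ : Type v} (e : σ ≃ τ) (m : MonomialOrder.{v, w} τ) :
    MonomialOrder.{u, w} σ where
  syn := m.syn
  toSyn := (Finsupp.domCongr e).trans m.toSyn
  toSyn_monotone := by
    intro a b hab
    exact m.toSyn_monotone fun i => by simpa using hab (e.symm i)

theorem exists_isCompatible (K : Type v) [Field K] {σ : Type u} [Finite σ] (y : σ) :
    ∃ m : MonomialOrder.{u, 0} σ, IsCompatible K m y := by
  obtain ⟨n, ⟨e₀⟩⟩ := Finite.exists_equiv_fin σ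
  -- The variable `y` gets the least index, which the lexicographic order compares first.
  obtain ⟨e, he⟩ : ∃ e : σ ≃ Fin n, ∀ i, e y ≤ i := by
    have : NeZero n := ⟨by rintro rfl; exact (e₀ y).elim0⟩
    exact ⟨e₀.trans (Equiv.swap (e₀ y) 0), fun i => by simp⟩
  refine ⟨monomialOrderCongr e MonomialOrder.lex, isCompatible_of_apply_le_apply fun a b h => ?_⟩
  by_contra! hlt
  refine absurd h (not_le.mpr ?_)
  change toLex (Finsupp.domCongr e b) < toLex (Finsupp.domCongr e a)
  rw [Finsupp.Lex.lt_iff]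
  refine ⟨e y, fun j hj => absurd (he j) (not_le.mpr hj), ?_⟩
  simpa using hlt

theorem exists_isGroebnerBasis {K : Type*} [Field K] {σ : Type*} [Finite σ] (m : MonomialOrder σ)
    (I : Ideal (MvPolynomial σ K)) : ∃ B, IsGroebnerBasis m I B := by
  classical
  have hfg : (initIdeal m I).FG := IsNoetherian.noetherian _
  obtain ⟨s, hs, hspan⟩ := Submodule.fg_span_iff_fg_span_finset_subset _ |>.mp hfg
  obtain ⟨B, hB, rfl⟩ := Finset.subset_set_image_iff.mp hs
  -- Zero may occur among the chosen preimages; discarding it does not change the span.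
  refine ⟨B.filter (· ≠ 0), fun b hb => hB (Finset.mem_filter.mp hb).1,
    fun b hb => (Finset.mem_filter.mp hb).2, ?_⟩
  apply le_antisymm
  · exact Ideal.span_mono (Set.image_mono fun b hb => hB (Finset.mem_filter.mp hb).1)
  · change Submodule.span _ _ ≤ _
    rw [hspan, Submodule.span_le]
    intro x hx
    obtain ⟨b, hb, rfl⟩ := Finset.mem_image.mp hx
    by_cases h0 : b = 0
    · simp [h0]
    · exact Ideal.subset_span ⟨b, by simpa using ⟨hb, h0⟩, rfl⟩

theorem IsGVD.of_polyIdeal {K : Type v} [Field K] {σ : Type u} [Finite σ]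
    (I : Ideal (MvPolynomial σ K)) (hU : IsUnmixed I) (y : σ)
    (hI : (polyIdeal y I).leadingCoeff ≤ (polyIdeal y I).leadingCoeffNth 1)
    (hC : IsGVD (polyIdeal y I).leadingCoeff) (hN : IsGVD ((polyIdeal y I).leadingCoeffNth 0)) :
    IsGVD I := by
  obtain ⟨m, hm⟩ := exists_isCompatible K y
  obtain ⟨B, hB⟩ := exists_isGroebnerBasis m I
  refine IsGVD.decomp I hU y m hm B hB ?_ ?_ ?_
  · rwa [hB.idealC_eq hm, hB.idealN_eq hm, ← comap_C_polyIdeal, initFormIdeal_eq_iff]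
  · rwa [hB.idealC_eq hm, contract_map_rename_val]
  · rwa [hB.idealN_eq hm, contract_map_rename_val]

/-- Induction for geometrically vertex decomposable ideals, in terms of leading coefficients. -/
theorem IsGVD.poly_induction {K : Type v} [Field K]
    {p : ∀ {σ : Type u}, Ideal (MvPolynomial σ K) → Prop}
    (top : ∀ {σ : Type u}, p (⊤ : Ideal (MvPolynomial σ K)))
    (vars : ∀ {σ : Type u} (I : Ideal (MvPolynomial σ K)) (s : Set σ), IsUnmixed I →
      I = Ideal.span (X '' s) → p I)
    (decomp : ∀ {σ : Type u} (I : Ideal (MvPolynomial σ K)) (y : σ), IsUnmixed I →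
      (polyIdeal y I).leadingCoeff ≤ (polyIdeal y I).leadingCoeffNth 1 →
      p (polyIdeal y I).leadingCoeff → p ((polyIdeal y I).leadingCoeffNth 0) → p I)
    {σ : Type u} {I : Ideal (MvPolynomial σ K)} (h : IsGVD I) : p I := by
  induction h with
  | top hU => exact top
  | decomp I hU y m hm B hB hI hC hN ihC ihN =>
    rw [hB.idealC_eq hm, hB.idealN_eq hm, ← comap_C_polyIdeal, initFormIdeal_eq_iff] at hI
    rw [hB.idealC_eq hm, contract_map_rename_val] at ihC
    rw [hB.idealN_eq hm, contract_map_rename_val] at ihN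
    exact decomp I y hU hI ihC ihN
  | _ I hU s hs => exact vars I s hU hs

end Existence

/-! ### Leading coefficient ideals of a join -/

section JoinStep

variable {K : Type*} [Field K] {σ τ ρ : Type*}

/-- The bijection induced by `σ ⊕ τ ≃ ρ` after removal of an element of `σ`. -/
def removeLeft (e : σ ⊕ τ ≃ ρ) (y : σ) :
    {x : σ // x ≠ y} ⊕ τ ≃ {x : ρ // x ≠ e (Sum.inl y)} :=
  Equiv.ofBijective
    (Sum.elim (fun x => ⟨e (Sum.inl x), by simpa using x.2⟩)
      (fun t => ⟨e (Sum.inr t), by simp⟩)) <| by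
    constructor
    · rintro (⟨x, hx⟩ | t) (⟨x', hx'⟩ | t') h <;> simp at h <;> simp [h]
    · rintro ⟨r, hr⟩
      obtain ⟨x | t, rfl⟩ := e.surjective r
      · exact ⟨Sum.inl ⟨x, by simpa using hr⟩, rfl⟩
      · exact ⟨Sum.inr t, rfl⟩

theorem toPoly_rename_inl (e : σ ⊕ τ ≃ ρ) (y : σ) (a : MvPolynomial σ K) :
    toPoly K (e (Sum.inl y)) (rename (e ∘ Sum.inl) a) =
      (toPoly K y a).map (rename (R := K) (removeLeft e y ∘ Sum.inl)).toRingHom := by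
  suffices (toPoly K (e (Sum.inl y))).toAlgHom.comp (rename (e ∘ Sum.inl)) =
      (Polynomial.mapAlgHom (rename (R := K) (removeLeft e y ∘ Sum.inl))).comp
        (toPoly K y).toAlgHom from DFunLike.congr_fun this a
  refine algHom_ext fun x => ?_
  simp only [AlgHom.comp_apply, rename_X, AlgEquiv.coe_toAlgHom, Function.comp_apply]
  by_cases hx : x = y
  · subst hx
    simp [toPoly_X_self]
  · have h1 := toPoly_rename_val (K := K) y (X ⟨x, hx⟩)
    have h2 := toPoly_rename_val (K := K) (e (Sum.inl y)) (X (removeLeft e y (Sum.inl ⟨x, hx⟩)))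
    rw [rename_X] at h1 h2
    rw [show X (e (Sum.inl x)) = X (removeLeft e y (Sum.inl ⟨x, hx⟩)).1 from rfl, h2,
      show X x = X (⟨x, hx⟩ : {x : σ // x ≠ y}).1 from rfl, h1]
    simp

theorem toPoly_rename_inr (e : σ ⊕ τ ≃ ρ) (y : σ) (b : MvPolynomial τ K) :
    toPoly K (e (Sum.inl y)) (rename (e ∘ Sum.inr) b) =
      Polynomial.C (rename (removeLeft e y ∘ Sum.inr) b) := by
  rw [← toPoly_rename_val, rename_rename]
  rfl

/-- The functional acts on the second block of variables and `y` belongs to the first, so the two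
operations commute. -/
theorem slice_coeff_toPoly (e : σ ⊕ τ ≃ ρ) (y : σ) (l : Module.Dual K (MvPolynomial τ K))
    (f : MvPolynomial ρ K) (n : ℕ) :
    slice (removeLeft e y) l ((toPoly K (e (Sum.inl y)) f).coeff n) =
      (toPoly K y (slice e l f)).coeff n := by
  refine mul_induction e f (fun a b => ?_) fun f g hf hg => ?_
  · rw [slice_mul, map_mul, toPoly_rename_inl, toPoly_rename_inr, Polynomial.coeff_mul_C,
      Polynomial.coeff_map, map_smul, Polynomial.coeff_smul]
    exact slice_mul _ _ _ _
  · simp only [map_add, Polynomial.coeff_add, hf, hg]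

/-- Using the coefficient in degree n instead of the leading one allows for slices, which may drop
the degree. -/
theorem mem_leadingCoeffNth_iff_coeff {R : Type*} [CommRing R] (I : Ideal (Polynomial R)) (n : ℕ)
    (x : R) : x ∈ I.leadingCoeffNth n ↔ ∃ p ∈ I, p.degree ≤ n ∧ p.coeff n = x := by
  simp only [Ideal.leadingCoeffNth, Ideal.degreeLE, Submodule.mem_map, Polynomial.lcoeff_apply,
    Submodule.mem_inf, Polynomial.mem_degreeLE]
  constructor
  · rintro ⟨p, ⟨h1, h2⟩, rfl⟩
    exact ⟨p, h2, h1, rfl⟩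
  · rintro ⟨p, h2, h1, rfl⟩
    exact ⟨p, ⟨h1, h2⟩, rfl⟩

/-- For ≤, slicing a polynomial of degree at most n in the join yields one in I, with the sliced
coefficient. For ≥, elements of I transfer directly, and b ∈ J is the degree-n coefficient of b·y^n.
-/
theorem leadingCoeffNth_join (e : σ ⊕ τ ≃ ρ) (y : σ) (I : Ideal (MvPolynomial σ K))
    (J : Ideal (MvPolynomial τ K)) (n : ℕ) :
    (polyIdeal (e (Sum.inl y)) (join e I J)).leadingCoeffNth n =
      join (removeLeft e y) ((polyIdeal y I).leadingCoeffNth n) J := by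
  apply le_antisymm
  · intro x hx
    obtain ⟨p, hp, hpn, rfl⟩ := (mem_leadingCoeffNth_iff_coeff _ _ _).mp hx
    obtain ⟨f, rfl⟩ := (toPoly K _).surjective p
    rw [mem_join_iff]
    intro l hl
    rw [slice_coeff_toPoly]
    refine (mem_leadingCoeffNth_iff_coeff _ _ _).mpr ⟨_, ?_, ?_, rfl⟩
    · exact toPoly_mem_polyIdeal.mpr
        ((mem_join_iff e I J f).mp (toPoly_mem_polyIdeal.mp hp) l hl)
    · rw [Polynomial.degree_le_iff_coeff_zero] at hpn ⊢
      intro k hk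
      rw [← slice_coeff_toPoly, hpn k hk, map_zero]
  · rw [join, sup_le_iff, Ideal.map_le_iff_le_comap, Ideal.map_le_iff_le_comap]
    constructor
    · intro x hx
      obtain ⟨p, hp, hpn, rfl⟩ := (mem_leadingCoeffNth_iff_coeff _ _ _).mp hx
      obtain ⟨f, rfl⟩ := (toPoly K _).surjective p
      refine (mem_leadingCoeffNth_iff_coeff _ _ _).mpr
        ⟨toPoly K (e (Sum.inl y)) (rename (e ∘ Sum.inl) f), ?_, ?_, ?_⟩
      · exact toPoly_mem_polyIdeal.mpr
          (Ideal.mem_sup_left (Ideal.mem_map_of_mem _ (toPoly_mem_polyIdeal.mp hp)))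
      · rw [toPoly_rename_inl]
        exact Polynomial.degree_map_le.trans hpn
      · rw [toPoly_rename_inl, Polynomial.coeff_map]
        rfl
    · intro b hb
      refine (mem_leadingCoeffNth_iff_coeff _ _ _).mpr
        ⟨toPoly K (e (Sum.inl y)) (rename (e ∘ Sum.inr) b) * Polynomial.X ^ n, ?_, ?_, ?_⟩
      · exact Ideal.mul_mem_right _ _ (toPoly_mem_polyIdeal.mpr
          (Ideal.mem_sup_right (Ideal.mem_map_of_mem _ hb)))
      · rw [toPoly_rename_inr]
        exact Polynomial.degree_C_mul_X_pow_le _ _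
      · rw [toPoly_rename_inr, Polynomial.coeff_C_mul_X_pow, if_pos rfl]

theorem leadingCoeff_join (e : σ ⊕ τ ≃ ρ) (y : σ) (I : Ideal (MvPolynomial σ K))
    (J : Ideal (MvPolynomial τ K)) :
    (polyIdeal (e (Sum.inl y)) (join e I J)).leadingCoeff =
      join (removeLeft e y) (polyIdeal y I).leadingCoeff J := by
  apply le_antisymm
  · refine iSup_le fun n => ?_
    rw [leadingCoeffNth_join]
    exact sup_le_sup_right (Ideal.map_mono (le_iSup (polyIdeal y I).leadingCoeffNth n)) _
  · have h : ∀ n, join (removeLeft e y) ((polyIdeal y I).leadingCoeffNth n) J ≤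
        (polyIdeal (e (Sum.inl y)) (join e I J)).leadingCoeff := fun n => by
      rw [← leadingCoeffNth_join]
      exact le_iSup (polyIdeal (e (Sum.inl y)) (join e I J)).leadingCoeffNth n
    rw [join, sup_le_iff]
    refine ⟨?_, le_sup_right.trans (h 0)⟩
    rw [Ideal.leadingCoeff, Ideal.map_iSup]
    exact iSup_le fun n => le_sup_left.trans (h n)

end JoinStep

/-! ### Joins generated by variables -/

section Variables

variable {K : Type*} [Field K] {σ τ ρ : Type*}

theorem join_span_X (e : σ ⊕ τ ≃ ρ) (s : Set σ) (t : Set τ) :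
    join e (Ideal.span (X '' s) : Ideal (MvPolynomial σ K)) (Ideal.span (X '' t)) =
      Ideal.span (X '' (e '' (Sum.inl '' s ∪ Sum.inr '' t))) := by
  rw [join, Ideal.map_span, Ideal.map_span, ← Ideal.span_union]
  congr 1
  simp only [Set.image_image, Set.image_union, rename_X, Function.comp_apply]

/-- Setting the variables of the second block to zero is a retraction that sends each generator to
zero or to a variable of the first block. -/
theorem eq_span_X_of_join_eq (e : σ ⊕ τ ≃ ρ) {I : Ideal (MvPolynomial σ K)}
    {J : Ideal (MvPolynomial τ K)} (hJ : J ≠ ⊤) {s : Set ρ}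
    (h : join e I J = Ideal.span (X '' s)) : I = Ideal.span (X '' ((e ∘ Sum.inl) ⁻¹' s)) := by
  have hinj : Function.Injective (e ∘ Sum.inl) := e.injective.comp Sum.inl_injective
  apply le_antisymm
  · intro a ha
    rw [← rename_inl_mem_join_iff e I hJ, h] at ha
    have := Ideal.mem_map_of_mem (killCompl hinj : MvPolynomial ρ K →ₐ[K] _) ha
    rw [killCompl_rename_app] at this
    refine Ideal.map_le_iff_le_comap.mpr (?_ : _ ≤ Ideal.comap (killCompl hinj)
      (Ideal.span (X '' ((e ∘ Sum.inl) ⁻¹' s)) : Ideal (MvPolynomial σ K))) this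
    rw [Ideal.span_le]
    rintro _ ⟨r, hr, rfl⟩
    obtain ⟨x | t, rfl⟩ := e.surjective r
    · have : killCompl (R := K) hinj (X (e (Sum.inl x))) = X x := by
        simpa using killCompl_rename_app hinj (X x : MvPolynomial σ K)
      rw [SetLike.mem_coe, Ideal.mem_comap, this]
      exact Ideal.subset_span ⟨x, hr, rfl⟩
    · have : killCompl (R := K) hinj (X (e (Sum.inr t))) = 0 := by
        rw [killCompl, aeval_X, dif_neg]
        simp
      rw [SetLike.mem_coe, Ideal.mem_comap, this]
      exact zero_mem _
  · rw [Ideal.span_le]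
    rintro _ ⟨x, hx, rfl⟩
    rw [SetLike.mem_coe, ← rename_inl_mem_join_iff e I hJ, h, rename_X]
    exact Ideal.subset_span ⟨_, hx, rfl⟩

end Variables

/-! ### Geometric vertex decomposability of a join -/

section Join

variable {K : Type w} [Field K]

theorem eq_top_of_join_eq_top {σ τ ρ : Type*} (e : σ ⊕ τ ≃ ρ) {I : Ideal (MvPolynomial σ K)}
    {J : Ideal (MvPolynomial τ K)} (hJ : J ≠ ⊤) (h : join e I J = ⊤) : I = ⊤ := by
  by_contra hI
  exact join_ne_top e hI hJ h

theorem isUnmixed_of_join {σ τ ρ : Type*} [Finite ρ] (e : σ ⊕ τ ≃ ρ)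
    {I : Ideal (MvPolynomial σ K)} {J : Ideal (MvPolynomial τ K)} (hJ : J ≠ ⊤)
    (h : IsUnmixed (join e I J)) : IsUnmixed I := by
  have : Finite (σ ⊕ τ) := .of_equiv _ e.symm
  have : Finite σ := .of_injective _ (Sum.inl_injective (β := τ))
  have : Finite τ := .of_injective _ (Sum.inr_injective (α := σ))
  by_cases hI : I = ⊤
  · exact hI ▸ isUnmixed_top
  · exact ((isUnmixed_join_iff e hI hJ).mp h).1

theorem isUnmixed_join {σ τ ρ : Type*} [Finite ρ] (e : σ ⊕ τ ≃ ρ)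
    {I : Ideal (MvPolynomial σ K)} {J : Ideal (MvPolynomial τ K)} (hI : IsUnmixed I)
    (hJ : IsUnmixed J) : IsUnmixed (join e I J) := by
  have : Finite (σ ⊕ τ) := .of_equiv _ e.symm
  have : Finite σ := .of_injective _ (Sum.inl_injective (β := τ))
  have : Finite τ := .of_injective _ (Sum.inr_injective (α := σ))
  by_cases hI' : I = ⊤
  · rw [hI', join_top_left]
    exact isUnmixed_top
  by_cases hJ' : J = ⊤
  · rw [hJ', join_top_right]
    exact isUnmixed_top
  exact (isUnmixed_join_iff e hI' hJ').mpr ⟨hI, hJ⟩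

theorem IsGVD.isUnmixed {σ : Type u} {I : Ideal (MvPolynomial σ K)} (h : IsGVD I) :
    IsUnmixed I := by
  cases h <;> assumption

/-- A decomposition step of the first factor gives a decomposition step of the join. -/
theorem IsGVD.join_of_step {σ : Type u} {τ : Type v} {ρ : Type*} [Finite ρ] (e : σ ⊕ τ ≃ ρ)
    {I : Ideal (MvPolynomial σ K)} {J : Ideal (MvPolynomial τ K)} (hI : IsUnmixed I)
    (hJ : IsUnmixed J) (y : σ)
    (hle : (polyIdeal y I).leadingCoeff ≤ (polyIdeal y I).leadingCoeffNth 1)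
    (hC : IsGVD (join (removeLeft e y) (polyIdeal y I).leadingCoeff J))
    (hN : IsGVD (join (removeLeft e y) ((polyIdeal y I).leadingCoeffNth 0) J)) :
    IsGVD (join e I J) := by
  refine IsGVD.of_polyIdeal _ (isUnmixed_join e hI hJ) (e (Sum.inl y)) ?_ ?_ ?_
  · rw [leadingCoeff_join, leadingCoeffNth_join]
    exact sup_le_sup_right (Ideal.map_mono hle) _
  · rwa [leadingCoeff_join]
  · rwa [leadingCoeffNth_join]

theorem IsGVD.join_variables {τ : Type v} {J : Ideal (MvPolynomial τ K)} (hJ : IsGVD J)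
    {σ : Type u} {ρ : Type x} [Finite ρ] (e : σ ⊕ τ ≃ ρ) (s : Set σ)
    (hs : IsUnmixed (Ideal.span (X '' s) : Ideal (MvPolynomial σ K))) :
    IsGVD (GVD.join e (Ideal.span (X '' s)) J) := by
  -- The ambient variable set is quantified inside the motive, since each step removes a variable
  -- from it.
  refine IsGVD.poly_induction (p := fun {τ} J => ∀ {ρ : Type x} [Finite ρ] (e : σ ⊕ τ ≃ ρ),
    IsGVD (GVD.join e (Ideal.span (X '' s)) J)) ?_ ?_ ?_ hJ e
  · intro τ ρ _ e
    rw [join_top_right]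
    exact IsGVD.top isUnmixed_top
  · intro τ J t hU ht ρ _ e
    subst ht
    exact IsGVD.variables _ (isUnmixed_join e hs hU) _ (join_span_X e s t)
  · intro τ J y hU hle ihC ihN ρ _ e
    rw [← join_sumComm]
    refine IsGVD.join_of_step _ hU hs y hle ?_ ?_
    · rw [← join_sumComm]
      exact ihC _
    · rw [← join_sumComm]
      exact ihN _

/-- The first factor is decomposed down to ideals generated by variables, with J kept fixed; in that
base case `IsGVD.join_variables` decomposes J. -/
theorem IsGVD.join {σ : Type u} {I : Ideal (MvPolynomial σ K)} (hI : IsGVD I) {τ : Type v}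
    {J : Ideal (MvPolynomial τ K)} (hJ : IsGVD J) {ρ : Type x} [Finite ρ] (e : σ ⊕ τ ≃ ρ) :
    IsGVD (GVD.join e I J) := by
  refine IsGVD.poly_induction (p := fun {σ} I => ∀ {ρ : Type x} [Finite ρ] (e : σ ⊕ τ ≃ ρ),
    IsGVD (GVD.join e I J)) ?_ ?_ ?_ hI e
  · intro σ ρ _ e
    rw [join_top_left]
    exact IsGVD.top isUnmixed_top
  · intro σ I s hU hs ρ _ e
    subst hs
    exact hJ.join_variables e s hU
  · intro σ I y hU hle ihC ihN ρ _ e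
    exact IsGVD.join_of_step e hU hJ.isUnmixed y hle (ihC _) (ihN _)

theorem IsGVD.left_of_step {σ : Type u} {τ : Type v} {ρ : Type*} [Finite ρ] (e : σ ⊕ τ ≃ ρ)
    {I : Ideal (MvPolynomial σ K)} {J : Ideal (MvPolynomial τ K)} (hJ : J ≠ ⊤)
    (hU : IsUnmixed (GVD.join e I J)) (y : σ)
    (hle : (polyIdeal (e (Sum.inl y)) (GVD.join e I J)).leadingCoeff ≤
      (polyIdeal (e (Sum.inl y)) (GVD.join e I J)).leadingCoeffNth 1)
    (hC : IsGVD (polyIdeal y I).leadingCoeff)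
    (hN : IsGVD ((polyIdeal y I).leadingCoeffNth 0)) : IsGVD I := by
  have : Finite (σ ⊕ τ) := .of_equiv _ e.symm
  have : Finite σ := .of_injective _ (Sum.inl_injective (β := τ))
  refine IsGVD.of_polyIdeal I (isUnmixed_of_join e hJ hU) y ?_ hC hN
  rwa [leadingCoeff_join, leadingCoeffNth_join, join_le_join_left_iff _ hJ] at hle

/-- The contraction of a proper ideal is proper. The full leading coefficient ideal need not be: for
I = ⟨y⟩ it is the unit ideal. -/
theorem leadingCoeffNth_zero_ne_top {σ : Type*} {I : Ideal (MvPolynomial σ K)} (hI : I ≠ ⊤)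
    (y : σ) : (polyIdeal y I).leadingCoeffNth 0 ≠ ⊤ := by
  rw [Ideal.ne_top_iff_one] at hI ⊢
  rwa [Ideal.mem_leadingCoeffNth_zero, mem_polyIdeal, map_one, map_one]

/-- Induction on the joined ideal, over all its splittings at once. Each conclusion assumes the
other factor proper, because a join with the unit ideal retains nothing of its partner. -/
theorem IsGVD.of_join {ρ : Type x} {M : Ideal (MvPolynomial ρ K)} (hM : IsGVD M) [Finite ρ]
    {σ : Type u} {τ : Type v} (e : σ ⊕ τ ≃ ρ) {I : Ideal (MvPolynomial σ K)}
    {J : Ideal (MvPolynomial τ K)} (h : GVD.join e I J = M) :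
    (J ≠ ⊤ → IsGVD I) ∧ (I ≠ ⊤ → IsGVD J) := by
  refine IsGVD.poly_induction (p := fun {ρ} M => ∀ [Finite ρ] {σ : Type u} {τ : Type v}
    (e : σ ⊕ τ ≃ ρ) {I : Ideal (MvPolynomial σ K)} {J : Ideal (MvPolynomial τ K)},
    GVD.join e I J = M → (J ≠ ⊤ → IsGVD I) ∧ (I ≠ ⊤ → IsGVD J)) ?_ ?_ ?_ hM e h
  · intro ρ _ σ τ e I J h
    constructor
    · intro hJ
      rw [eq_top_of_join_eq_top e hJ h]
      exact IsGVD.top isUnmixed_top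
    · intro hI
      rw [← join_sumComm] at h
      rw [eq_top_of_join_eq_top _ hI h]
      exact IsGVD.top isUnmixed_top
  · intro ρ M s hU hs _ σ τ e I J h
    constructor
    · intro hJ
      exact IsGVD.variables I (isUnmixed_of_join e hJ (h ▸ hU)) _
        (eq_span_X_of_join_eq e hJ (h.trans hs))
    · intro hI
      rw [← join_sumComm] at h
      exact IsGVD.variables J (isUnmixed_of_join _ hI (h ▸ hU)) _
        (eq_span_X_of_join_eq _ hI (h.trans hs))
  · intro ρ M y hU hle ihC ihN _ σ τ e I J h
    subst h
    obtain ⟨y | y, rfl⟩ := e.surjective y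
    · have ihC' := ihC (removeLeft e y) (leadingCoeff_join e y I J).symm
      have ihN' := ihN (removeLeft e y) (leadingCoeffNth_join e y I J 0).symm
      -- The step descends to I, the factor containing `y`. The other factor J is unchanged and is
      -- recovered from the N branch: there the partner of J stays proper, while in the C branch it
      -- may become the unit ideal.
      exact ⟨fun hJ => IsGVD.left_of_step e hJ hU y hle (ihC'.1 hJ) (ihN'.1 hJ),
        fun hI => ihN'.2 (leadingCoeffNth_zero_ne_top hI y)⟩
    · have hsymm := join_sumComm e I J
      rw [← hsymm] at hU hle ihC ihN
      have ihC' := ihC ((Equiv.sumComm _ _).trans (removeLeft ((Equiv.sumComm τ σ).trans e) y))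
        ((join_sumComm _ _ _).trans
          (leadingCoeff_join ((Equiv.sumComm τ σ).trans e) y J I).symm)
      have ihN' := ihN ((Equiv.sumComm _ _).trans (removeLeft ((Equiv.sumComm τ σ).trans e) y))
        ((join_sumComm _ _ _).trans
          (leadingCoeffNth_join ((Equiv.sumComm τ σ).trans e) y J I 0).symm)
      exact ⟨fun hJ => ihN'.1 (leadingCoeffNth_zero_ne_top hJ y),
        fun hI => IsGVD.left_of_step ((Equiv.sumComm τ σ).trans e) hI hU y hle
          (ihC'.2 hI) (ihN'.2 hI)⟩

theorem isGVD_join_iff {ρ : Type x} [Finite ρ] {σ : Type u} {τ : Type v} (e : σ ⊕ τ ≃ ρ)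
    {I : Ideal (MvPolynomial σ K)} {J : Ideal (MvPolynomial τ K)} (hI : I ≠ ⊤) (hJ : J ≠ ⊤) :
    IsGVD (GVD.join e I J) ↔ IsGVD I ∧ IsGVD J := by
  refine ⟨fun h => ?_, fun h => h.1.join h.2 e⟩
  have := h.of_join e rfl
  exact ⟨this.1 hJ, this.2 hI⟩

end Join

/-! ### The toric ideal of a disjoint union -/

section Toric

variable {K : Type w} [Field K] {V : Type u} {W : Type v}

/-- The parametrization of the edge ring of a graph. -/
def toricMap (K : Type w) [Field K] {V : Type u} (G : SimpleGraph V) :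
    MvPolynomial G.edgeSet K →ₐ[K] MvPolynomial V K :=
  aeval fun e : G.edgeSet => ((e : Sym2 V).map (X : V → MvPolynomial V K)).mul

theorem mem_toricIdeal {G : SimpleGraph V} {f : MvPolynomial G.edgeSet K} :
    f ∈ toricIdeal K G ↔ toricMap K G f = 0 := Iff.rfl

theorem toricIdeal_ne_top (G : SimpleGraph V) : toricIdeal K G ≠ ⊤ := by
  rw [Ideal.ne_top_iff_one, mem_toricIdeal, map_one]
  exact one_ne_zero

theorem toricMap_sum_inl (G : SimpleGraph V) (L : SimpleGraph W) (a : MvPolynomial G.edgeSet K) :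
    toricMap K (G ⊕g L) (rename (SimpleGraph.edgeSetSumEquiv.symm ∘ Sum.inl) a) =
      rename (Equiv.refl (V ⊕ W) ∘ Sum.inl) (toricMap K G a) := by
  suffices (toricMap K (G ⊕g L)).comp (rename (SimpleGraph.edgeSetSumEquiv.symm ∘ Sum.inl)) =
      (rename (Equiv.refl (V ⊕ W) ∘ Sum.inl)).comp (toricMap K G) from DFunLike.congr_fun this a
  refine algHom_ext fun x => ?_
  obtain ⟨⟨a, b⟩, h⟩ := x
  simp only [AlgHom.comp_apply, rename_X, toricMap, aeval_X, Function.comp_apply]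
  change X (Sum.inl a) * X (Sum.inl b) = rename _ (X a * X b)
  simp

theorem toricMap_sum_inr (G : SimpleGraph V) (L : SimpleGraph W) (a : MvPolynomial L.edgeSet K) :
    toricMap K (G ⊕g L) (rename (SimpleGraph.edgeSetSumEquiv.symm ∘ Sum.inr) a) =
      rename (Equiv.refl (V ⊕ W) ∘ Sum.inr) (toricMap K L a) := by
  suffices (toricMap K (G ⊕g L)).comp (rename (SimpleGraph.edgeSetSumEquiv.symm ∘ Sum.inr)) =
      (rename (Equiv.refl (V ⊕ W) ∘ Sum.inr)).comp (toricMap K L) from DFunLike.congr_fun this a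
  refine algHom_ext fun x => ?_
  obtain ⟨⟨a, b⟩, h⟩ := x
  simp only [AlgHom.comp_apply, rename_X, toricMap, aeval_X, Function.comp_apply]
  change X (Sum.inr a) * X (Sum.inr b) = rename _ (X a * X b)
  simp

theorem toricMap_slice (G : SimpleGraph V) (L : SimpleGraph W)
    (l : Module.Dual K (MvPolynomial W K)) (f : MvPolynomial (G ⊕g L).edgeSet K) :
    toricMap K G (slice SimpleGraph.edgeSetSumEquiv.symm (l ∘ₗ (toricMap K L).toLinearMap) f) =
      slice (Equiv.refl (V ⊕ W)) l (toricMap K (G ⊕g L) f) := by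
  refine mul_induction SimpleGraph.edgeSetSumEquiv.symm f (fun a b => ?_) fun f g hf hg => ?_
  · rw [slice_mul, map_mul, toricMap_sum_inl, toricMap_sum_inr, slice_mul, map_smul]
    rfl
  · simp only [map_add, hf, hg]

/-- A functional that vanishes on the second toric ideal is the pullback of one on the polynomial
ring of the vertices. Slicing by it commutes with the parametrizations (`toricMap_slice`), so the
slices of an element of the kernel lie in the first toric ideal. -/
theorem toricIdeal_sum (G : SimpleGraph V) (L : SimpleGraph W) :
    toricIdeal K (G ⊕g L) =
      GVD.join SimpleGraph.edgeSetSumEquiv.symm (toricIdeal K G) (toricIdeal K L) := by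
  apply le_antisymm
  · intro f hf
    rw [mem_join_iff]
    intro l hl
    have hmem : l ∈ (LinearMap.ker (toricMap K L).toLinearMap).dualAnnihilator := by
      rw [Submodule.mem_dualAnnihilator]
      exact hl
    rw [← LinearMap.range_dualMap_eq_dualAnnihilator_ker] at hmem
    obtain ⟨l', rfl⟩ := hmem
    rw [mem_toricIdeal] at hf ⊢
    exact (toricMap_slice G L l' f).trans (by rw [hf, map_zero])
  · rw [GVD.join, sup_le_iff, Ideal.map_le_iff_le_comap, Ideal.map_le_iff_le_comap]
    constructor
    · intro a ha
      rw [mem_toricIdeal] at ha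
      rw [Ideal.mem_comap, mem_toricIdeal, toricMap_sum_inl, ha, map_zero]
    · intro a ha
      rw [mem_toricIdeal] at ha
      rw [Ideal.mem_comap, mem_toricIdeal, toricMap_sum_inr, ha, map_zero]

end Toric

end GVD

end

theorem mainTheorem12 {K : Type w} [Field K] [IsAlgClosed K] [CharZero K]
    {V : Type u} {W : Type v} [Finite V] [Finite W]
    (H : SimpleGraph V) (L : SimpleGraph W) :
    GVD.IsGVD (GVD.toricIdeal K (H ⊕g L)) ↔
      GVD.IsGVD (GVD.toricIdeal K H) ∧ GVD.IsGVD (GVD.toricIdeal K L) := by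
  rw [GVD.toricIdeal_sum]
  exact GVD.isGVD_join_iff _ (GVD.toricIdeal_ne_top H) (GVD.toricIdeal_ne_top L)
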